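/- Let $n,N\ge 1$ and let $f(w)=\prod_{i=1}^{n+1}\frac{w-w_{a_i}}{w-w_{b_i}}$, where $w_{a_1},\dots,w_{a_{n+1}}$ are real and pairwise distinct, $w_{a_i}\neq w_{b_k}$ for all $i,k$, and the poles $w_{b_1},\dots,w_{b_{n+1}}\in\mathbb C$ (repetitions allowed) are real or pairwise complex conjugate. Let $w_{u_k}\in\mathbb C$ and $w_{v_k}=\overline{w_{u_k}}$ $(1\le k\le N)$ satisfy $w_{v_i}\ne w_{u_k}$ for all $i,k$ (in particular no $w_{u_k}$ is real) and $f(w_{u_k})=f(w_{v_k})$, an equality in $\mathbb C\cup\{\infty\}$. Let $\theta\in\mathbb R$ and $d\in\mathbb R^N$. Write $a=w_{a_{n+1}}$ and, for $1\le j\le n$, $1\le k\le N$, put $$V_k=\frac1{f'(a)}\Big(\frac1{a-w_{v_k}}-\frac1{a-w_{u_k}}\Big),\qquad W_k=\frac1{f'(a)^2}\Big(-\frac1{(a-w_{v_k})^2}+\frac1{(a-w_{u_k})^2}\Big)-\frac{f''(a)}{f'(a)^2}V_k,$$ $$r_{j,k}=\ln\Big\{\frac{w_{a_j}-w_{v_k}}{w_{a_j}-w_{u_k}}\,\frac{a-w_{u_k}}{a-w_{v_k}}\Big\},\qquad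 q_j=\frac1{f'(a)f'(w_{a_j})(a-w_{a_j})^2},$$ $$E_j=\frac1{f'(a)(w_{a_j}-a)}-\frac12\frac{f''(a)}{f'(a)^2},\qquad F_j=-E_j^2+2\sum_{k=1}^n q_k,\qquad A_j=|q_j|^{1/2},$$ and for $\beta\in\{0,1\}$ let $\mathbb T_{j,\beta}(x,t)$ be the $N\times N$ matrix with entries $$(\mathbb T_{j,\beta})_{ik}=\delta_{ik}+\frac{w_{v_i}-w_{u_i}}{w_{v_i}-w_{u_k}}\,e^{\frac12(z_i+z_k)},\qquad z_k=\mathrm iV_kx+\mathrm iW_kt-d_k+\beta r_{j,k}$$ (its determinant does not depend on the branches of the logarithms; the principal branch is used). Put $s_j=\operatorname{sign}\big(f'(w_{a_{n+1}})f'(w_{a_j})\big)$ and $$\psi_j(x,t)=A_j\,e^{\mathrm i\theta}\,\frac{\det\mathbb T_{j,1}(x,t)}{\det\mathbb T_{j,0}(x,t)}\,e^{\mathrm i(-E_jx+F_jt)},\qquad x,t\in\mathbb R.$$ Then each $f'(w_{a_{n+1}})f'(w_{a_j})$ is real and nonzero, so that $s_j=\pm1$; $s=(s_1,\dots,s_n)\neq(1,\dots,1)$;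 $\det\mathbb T_{j,0}$ vanishes nowhere on $\mathbb R^2$ and every $\psi_j$ is $C^\infty$ on $\mathbb R^2$; the functions $\psi_1,\dots,\psi_n$ solve the system n-NLS$^s$ $$\mathrm i\,\partial_t\psi_j+\partial_x^2\psi_j+2\Big(\sum_{k=1}^n s_k|\psi_k|^2\Big)\psi_j=0,\qquad j=1,\dots,n;$$ and they are dark solitons: for every $j$, $A_j>0$, $|\psi_j(x,t)|<A_j$ for all $x,t\in\mathbb R$, and for every $t\in\mathbb R$, $|\psi_j(x,t)|\to A_j$ as $x\to+\infty$ and as $x\to-\infty$. -/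

import Mathlib

open scoped ContDiff ComplexConjugate

namespace DarkNLS

noncomputable section

/-- The function `f(w) = ∏ i, (w - a i) / (w - b i)` of degree `m` on the sphere, with zeros `a i`
and poles `b i`. At a pole the value is `0` in place of `∞`. For the equation `f u = f v` with
`v = conj u`, `u` not real, real zeros, and poles that are real or pairwise conjugate, this agrees
with equality on the sphere: `u` is a pole if and only if `v` is, and `f` does not vanish at either. -/
def ratFun {m : ℕ} (a b : Fin m → ℂ) (w : ℂ) : ℂ :=
  ∏ i, (w - a i) / (w - b i)

/-- The family `b` is, with multiplicities, invariant under complex conjugation: its members are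
real or pairwise conjugate. -/
def ConjInvariant {m : ℕ} (b : Fin m → ℂ) : Prop :=
  ∃ σ : Equiv.Perm (Fin m), ∀ i, conj (b i) = b (σ i)

/-- `V_{p,k}`, for the local parameter `w ↦ f w - f p` at `p` and `uk = w_{u_k}`, `vk = w_{v_k}`. -/
def V (f : ℂ → ℂ) (p uk vk : ℂ) : ℂ :=
  1 / deriv f p * (1 / (p - vk) - 1 / (p - uk))

/-- `W_{p,k}`, for the local parameter `w ↦ f w - f p` at `p`. -/
def W (f : ℂ → ℂ) (p uk vk : ℂ) : ℂ :=
  1 / deriv f p ^ 2 * (-(1 / (p - vk) ^ 2) + 1 / (p - uk) ^ 2)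
    - iteratedDeriv 2 f p / deriv f p ^ 2 * V f p uk vk

/-- `r_k = ln {(q - vk)/(q - uk) * (p - uk)/(p - vk)}`. The determinants below do not depend on the
branch of the logarithm; the principal one is used. -/
def r (p q uk vk : ℂ) : ℂ :=
  Complex.log ((q - vk) / (q - uk) * ((p - uk) / (p - vk)))

/-- `q₂(p, q)`. -/
def q2 (f : ℂ → ℂ) (p q : ℂ) : ℂ :=
  1 / (deriv f p * deriv f q * (p - q) ^ 2)

/-- `K₁(p, q)`. -/
def K1 (f : ℂ → ℂ) (p q : ℂ) : ℂ :=
  1 / (deriv f p * (q - p)) - 1 / 2 * (iteratedDeriv 2 f p / deriv f p ^ 2)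

/-- The matrix `𝕋` with entries
`δ_{ik} + (v_i - u_i) / (v_i - u_k) * exp ((z_i + z_k) / 2)`. -/
def T {N : ℕ} (u v z : Fin N → ℂ) : Matrix (Fin N) (Fin N) ℂ :=
  Matrix.of fun i k =>
    (if i = k then 1 else 0)
      + (v i - u i) / (v i - u k) * Complex.exp (1 / 2 * (z i + z k))

/-- `Z_k(x, t) = i V_{p,k} x + i W_{p,k} t`. -/
def Z (f : ℂ → ℂ) (p uk vk : ℂ) (x t : ℝ) : ℂ :=
  Complex.I * V f p uk vk * x + Complex.I * W f p uk vk * t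

/-- The argument `z^j_k = Z_k - d_k + β r_{j,k}` with `p = w_{a_{n+1}}`, `q = w_{a_j}`. -/
def zArg {N : ℕ} (f : ℂ → ℂ) (p q : ℂ) (u v : Fin N → ℂ) (d : Fin N → ℝ) (β : ℂ) (x t : ℝ) :
    Fin N → ℂ :=
  fun k => Z f p (u k) (v k) x t - (d k : ℂ) + β * r p q (u k) (v k)

/-- The amplitude `A_j = |q₂(a_{n+1}, a_j)|^{1/2}`; the point `a_{n+1}` is `a (Fin.last n)`. -/
def amp {n : ℕ} (a b : Fin (n + 1) → ℂ) (j : Fin n) : ℝ :=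
  Real.sqrt ‖q2 (ratFun a b) (a (Fin.last n)) (a j.castSucc)‖

/-- `E_j = K₁(a_{n+1}, a_j)`. -/
def E {n : ℕ} (a b : Fin (n + 1) → ℂ) (j : Fin n) : ℂ :=
  K1 (ratFun a b) (a (Fin.last n)) (a j.castSucc)

/-- `F_j = - K₁(a_{n+1}, a_j)² + 2 ∑_{k=1}^n q₂(a_{n+1}, a_k)`. -/
def F {n : ℕ} (a b : Fin (n + 1) → ℂ) (j : Fin n) : ℂ :=
  -K1 (ratFun a b) (a (Fin.last n)) (a j.castSucc) ^ 2
    + 2 * ∑ k : Fin n, q2 (ratFun a b) (a (Fin.last n)) (a k.castSucc)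

/-- The determinantal formula
`ψ_j = A_j e^{iθ} det 𝕋_{j,1} / det 𝕋_{j,0} exp (i (-E_j x + F_j t))`. -/
def darkPsi {n N : ℕ} (a b : Fin (n + 1) → ℂ) (u v : Fin N → ℂ) (d : Fin N → ℝ) (θ : ℝ)
    (j : Fin n) (x t : ℝ) : ℂ :=
  (amp a b j : ℂ) * Complex.exp (Complex.I * θ)
    * ((T u v (zArg (ratFun a b) (a (Fin.last n)) (a j.castSucc) u v d 1 x t)).det
      / (T u v (zArg (ratFun a b) (a (Fin.last n)) (a j.castSucc) u v d 0 x t)).det)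
    * Complex.exp (Complex.I * (-E a b j * x + F a b j * t))

/-- `s_j = sign (f'(w_{a_{n+1}}) f'(w_{a_j}))` (the product is a real number when the zeros are real
and the poles are real or pairwise conjugate). -/
def darkSign {n : ℕ} (a b : Fin (n + 1) → ℂ) (j : Fin n) : ℝ :=
  Real.sign
    (deriv (ratFun a b) (a (Fin.last n)) * deriv (ratFun a b) (a j.castSucc)).re

/-- The system n-NLS^s:
`i ∂_t ψ_j + ∂_x² ψ_j + 2 (∑_k s_k |ψ_k|²) ψ_j = 0`, `j = 1, …, n`. -/
def SolvesNLS {n : ℕ} (s : Fin n → ℝ) (ψ : Fin n → ℝ → ℝ → ℂ) : Prop :=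
  ∀ (j : Fin n) (x t : ℝ),
    Complex.I * deriv (fun τ : ℝ => ψ j x τ) t + iteratedDeriv 2 (fun ξ : ℝ => ψ j ξ t) x
      + 2 * (∑ k : Fin n, (s k : ℂ) * ((‖ψ k x t‖ : ℝ) : ℂ) ^ 2) * ψ j x t = 0

/-- `φ` is dark on the background of amplitude `A`: its modulus tends to the nonzero constant `A` as
`x → ±∞` at every time, and is everywhere smaller than `A`. -/
def IsDark (A : ℝ) (φ : ℝ → ℝ → ℂ) : Prop :=
  0 < A ∧ (∀ x t : ℝ, ‖φ x t‖ < A) ∧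
    ∀ t : ℝ, Filter.Tendsto (fun x : ℝ => ‖φ x t‖) Filter.atTop (nhds A) ∧
      Filter.Tendsto (fun x : ℝ => ‖φ x t‖) Filter.atBot (nhds A)

end

end DarkNLS

/-!
The proof passes to the function `1 / f`. Its partial fraction decomposition (`inv_ratFun`) is
`1 + ∑ 1 / (f'(aᵢ) (w - aᵢ))`, with real residues, so `f u = f ū` says that
`∑ 1 / (f'(aᵢ) |u - aᵢ|²) = 0` (`sum_residues_eq_zero`). In the Möbius coordinate `spectral`, which
moves `a_{n+1}` to infinity, the points `u k` become non-real spectral parameters `l k` for which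
`V = l̄ - l`, `W = l² - l̄²`, the phases `exp r` become `(l̄ + E) / (l + E)`, and the relation
becomes `1 + ∑ qⱼ / |l + Eⱼ|² = 0` (`spec_condition`); here `qⱼ = sⱼ Aⱼ²`. In particular the signs
cannot all be positive.

The determinant of `T` is the value of `tau l y = det (1 + diag y · C)`, with `C` the normalised
Cauchy matrix of `l`, at `y = exp z` (`det_T_eq_tau`). Its expansion in principal minors of `C` has
nonnegative coefficients, whatever half-planes the `l k` lie in, and a coefficient vanishes exactly
when it involves a repeated point (`tauCoeff_spec`). Hence the denominator is positive; the
numerator, where the `y k` carry unimodular phases different from `1`, is strictly smaller in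
modulus (`norm_tau_phase_lt`); and as `x → ±∞` all dominant terms carry one common phase
(`tendsto_norm_tau_phase_div`), so that the quotient of the moduli tends to `1`.

For the equations, a diagonal gauge transformation turns the denominator into the determinant of a
matrix `M` with `M_x = α βᵀ` and `diag l̄ · M - M · diag l = diag (l̄ - l) - i α βᵀ`. The phases in
the numerator amount to a perturbation of rank one, so the quotient is
`h = 1 - i ⟨(l + E)⁻¹, 1⟩` in terms of the bracket `⟨g, f⟩ = (gβ)ᵀ M⁻¹ (αf)`
(`tauRatio_eq_dressedFun`). The derivatives of brackets are polynomials in brackets, and with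
`w = ⟨1, 1⟩` the function `h` satisfies the linear equation `i h_t + h_xx - 2 i E h_x + 2 w_x h = 0`
(`exists_derivs_dressedFun`). The relation on the spectral parameters enters only in the reduction
`w_x = ∑ qⱼ (|hⱼ|² - 1)` (`sum_mul_sub_one`), which closes the system. Multiplication by the plane
waves gives the equations for `ψ`.
-/

namespace DarkSoliton

open Matrix Filter

variable {ι : Type} [Fintype ι] [DecidableEq ι]

/-! ### Cauchy determinants and the tau function -/

/-- Similar matrices under a diagonal gauge transformation have the same determinant. -/
theorem det_eq_of_gauge {A B : Matrix ι ι ℂ} (s : ι → ℂ) (hs : ∀ i, s i ≠ 0)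
    (h : ∀ i k, s i * B i k = A i k * s k) : A.det = B.det := by
  have hm : diagonal s * B = A * diagonal s := by
    ext i k
    rw [diagonal_mul, mul_diagonal, h]
  have hd := congrArg det hm
  rw [det_mul, det_mul, mul_comm A.det] at hd
  refine (mul_left_cancel₀ ?_ hd).symm
  rw [det_diagonal]
  exact Finset.prod_ne_zero_iff.mpr fun i _ => hs i

/-- The normalised Cauchy matrix `(ūᵢ - uᵢ) / (ūᵢ - uₖ)`. -/
noncomputable def cauchyMatrix {ι : Type} (u : ι → ℂ) : Matrix ι ι ℂ :=
  of fun i k => (conj (u i) - u i) / (conj (u i) - u k)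

/-- The tau function `det (1 + diag y · C)` of the Cauchy matrix `C` of `u`. -/
noncomputable def tau (u y : ι → ℂ) : ℂ :=
  (1 + diagonal y * cauchyMatrix u).det

/-- Splitting off one point from a Cauchy determinant: the Schur complement of the diagonal entry of
the new point is the smaller Cauchy matrix multiplied on both sides by diagonal matrices. -/
theorem det_cauchyMatrix_option (u : Option ι → ℂ) (hu : ∀ i k, conj (u i) ≠ u k) :
    (cauchyMatrix u).det = (cauchyMatrix fun i => u (some i)).det *
      ∏ i : ι, (((‖u (some i) - u none‖ / ‖conj (u (some i)) - u none‖) ^ 2 : ℝ) : ℂ) := by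
  have hd : ∀ i k, conj (u i) - u k ≠ 0 := fun i k => sub_ne_zero.mpr (hu i k)
  let e : Option ι ≃ ι ⊕ Unit := Equiv.optionEquivSumPUnit ι
  let Bc : Matrix ι Unit ℂ := of fun i _ => cauchyMatrix u (some i) none
  let Cr : Matrix Unit ι ℂ := of fun _ k => cauchyMatrix u none (some k)
  have hblock : (cauchyMatrix u).submatrix e.symm e.symm =
      fromBlocks (cauchyMatrix fun i => u (some i)) Bc Cr 1 := by
    ext (i | i) (k | k)
    · rfl
    · rfl
    · rfl
    · simp [e, cauchyMatrix, hd]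
  have hschur : cauchyMatrix (fun i => u (some i)) - Bc * Cr =
      diagonal (fun i => (conj (u (some i)) - conj (u none)) / (conj (u (some i)) - u none)) *
        cauchyMatrix (fun i => u (some i)) *
        diagonal (fun k => (u none - u (some k)) / (conj (u none) - u (some k))) := by
    ext i k
    have h1 := hd (some i) (some k)
    have h2 := hd (some i) none
    have h3 := hd none (some k)
    rw [Matrix.sub_apply, mul_diagonal, diagonal_mul, mul_apply, Fintype.sum_unique]
    simp only [Bc, Cr, cauchyMatrix, of_apply]
    field_simp
    ring
  rw [← det_submatrix_equiv_self e.symm, hblock, det_fromBlocks_one₂₂, hschur, det_mul, det_mul,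
    det_diagonal, det_diagonal, mul_assoc, mul_left_comm, ← Finset.prod_mul_distrib]
  congr 1
  refine Finset.prod_congr rfl fun i _ => ?_
  have h2 := hd (some i) none
  have h3 := hd none (some i)
  have h4 : u (some i) - conj (u none) ≠ 0 := by
    rw [← neg_ne_zero, neg_sub]; exact h3
  push_cast
  rw [div_pow, ← Complex.mul_conj', ← Complex.mul_conj']
  simp only [map_sub, Complex.conj_conj]
  field_simp
  ring

/-- The Cauchy determinant attached to non-real points whose conjugates avoid them is a nonnegative
real number, and it vanishes exactly when a point is repeated. The points may lie in both
half-planes, so the Cauchy matrix itself need not be definite. -/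
theorem exists_det_cauchyMatrix (ι : Type) [Fintype ι] [DecidableEq ι] :
    ∀ u : ι → ℂ, (∀ i k, conj (u i) ≠ u k) →
      ∃ c : ℝ, 0 ≤ c ∧ (c ≠ 0 ↔ Function.Injective u) ∧ (cauchyMatrix u).det = c := by
  refine Finite.induction_empty_option (P := fun κ => ∀ [Fintype κ] [DecidableEq κ] (u : κ → ℂ),
    (∀ i k, conj (u i) ≠ u k) →
      ∃ c : ℝ, 0 ≤ c ∧ (c ≠ 0 ↔ Function.Injective u) ∧ (cauchyMatrix u).det = c)
    ?_ ?_ ?_ ι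
  · intro κ κ' e h _ _ u hu
    let _ : Fintype κ := Fintype.ofEquiv κ' e.symm
    let _ : DecidableEq κ := e.injective.decidableEq
    obtain ⟨c, h0, h1, h2⟩ := h (fun i => u (e i)) fun i k => hu _ _
    refine ⟨c, h0, h1.trans ?_, ?_⟩
    · exact Function.Injective.of_comp_iff' (f := u) e.bijective
    · rw [← h2, ← det_submatrix_equiv_self e]
      rfl
  · intro _ _ u _
    refine ⟨1, zero_le_one, ?_, ?_⟩
    · simp [Function.injective_of_subsingleton]
    · simp
  · intro κ _ h _ _ u hu
    classical
    obtain ⟨c, h0, h1, h2⟩ := h (fun i => u (some i)) fun i k => hu _ _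
    refine ⟨c * ∏ i : κ, (‖u (some i) - u none‖ / ‖conj (u (some i)) - u none‖) ^ 2,
      mul_nonneg h0 (Finset.prod_nonneg fun i _ => sq_nonneg _), ?_, ?_⟩
    · rw [mul_ne_zero_iff, h1, Finset.prod_ne_zero_iff]
      have hd : ∀ i k, ‖conj (u i) - u k‖ ≠ 0 := fun i k =>
        norm_ne_zero_iff.mpr (sub_ne_zero.mpr (hu i k))
      have hp : ∀ i : κ, (‖u (some i) - u none‖ / ‖conj (u (some i)) - u none‖) ^ 2 ≠ 0 ↔
          u (some i) ≠ u none := fun i => by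
        rw [ne_eq, pow_eq_zero_iff two_ne_zero, div_eq_zero_iff, norm_eq_zero, sub_eq_zero,
          or_iff_left (hd _ _)]
      simp only [Finset.mem_univ, forall_true_left, hp]
      constructor
      · rintro ⟨hi, hn⟩ (_ | i) (_ | k) hik
        · rfl
        · exact absurd hik.symm (hn k)
        · exact absurd hik (hn i)
        · rw [hi hik]
      · intro hi
        exact ⟨fun i k hik => Option.some_injective _ (hi hik), fun i hin => by
          simpa using hi hin⟩
    · have := det_cauchyMatrix_option u hu
      rw [h2] at this
      push_cast at this ⊢
      convert this

/-- The determinant of `1 + M` is the sum of the principal minors of `M`. -/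
theorem det_one_add_eq_sum_minors (M : Matrix ι ι ℂ) :
    (1 + M).det = ∑ s : Finset ι, (M.submatrix ((↑) : s → ι) ((↑) : s → ι)).det := by
  have h := (detRowAlternating : (ι → ℂ) [⋀^ι]→ₗ[ℂ] ℂ).map_add_univ
    (fun i => M i) (fun i => (1 : Matrix ι ι ℂ) i)
  rw [add_comm]
  refine Eq.trans h (Finset.sum_congr rfl fun s _ => ?_)
  exact det_piecewise_one_eq_submatrix_det M s

/-- The coefficient of `∏ k ∈ s, y k` in the tau function: a principal Cauchy minor. -/
noncomputable def tauCoeff (u : ι → ℂ) (s : Finset ι) : ℝ :=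
  ((cauchyMatrix u).submatrix ((↑) : s → ι) ((↑) : s → ι)).det.re

omit [Fintype ι] in
theorem tauCoeff_spec {u : ι → ℂ} (hu : ∀ i k, conj (u i) ≠ u k) (s : Finset ι) :
    0 ≤ tauCoeff u s ∧ (tauCoeff u s ≠ 0 ↔ Set.InjOn u s) ∧
      ((cauchyMatrix u).submatrix ((↑) : s → ι) ((↑) : s → ι)).det = tauCoeff u s := by
  obtain ⟨c, h0, h1, h2⟩ := exists_det_cauchyMatrix s (fun i => u i) fun i k => hu _ _
  have h3 : ((cauchyMatrix u).submatrix ((↑) : s → ι) ((↑) : s → ι)).det = c := h2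
  have h4 : tauCoeff u s = c := by rw [tauCoeff, h3, Complex.ofReal_re]
  rw [h4, h3]
  refine ⟨h0, h1.trans ?_, rfl⟩
  exact Set.injOn_iff_injective.symm

/-- The tau function is a multi-affine polynomial with nonnegative coefficients. -/
theorem tau_eq_sum {u : ι → ℂ} (hu : ∀ i k, conj (u i) ≠ u k) (y : ι → ℂ) :
    tau u y = ∑ s : Finset ι, (tauCoeff u s : ℂ) * ∏ k ∈ s, y k := by
  rw [tau, det_one_add_eq_sum_minors]
  refine Finset.sum_congr rfl fun s _ => ?_
  rw [← (tauCoeff_spec hu s).2.2]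
  have : (diagonal y * cauchyMatrix u).submatrix ((↑) : s → ι) ((↑) : s → ι) =
      diagonal (fun i : s => y i) * (cauchyMatrix u).submatrix ((↑) : s → ι) ((↑) : s → ι) := by
    ext i k
    simp [diagonal_mul]
  rw [this, det_mul, det_diagonal, mul_comm, Finset.prod_coe_sort s y]

theorem conj_tau {u : ι → ℂ} (hu : ∀ i k, conj (u i) ≠ u k) (y : ι → ℂ) :
    conj (tau u y) = tau u fun i => conj (y i) := by
  rw [tau_eq_sum hu, tau_eq_sum hu, map_sum]
  refine Finset.sum_congr rfl fun s _ => ?_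
  rw [map_mul, Complex.conj_ofReal, map_prod]

/-! ### Size of the tau function with phases -/

/-- The real form of the tau function at real arguments. -/
noncomputable def realTau (u : ι → ℂ) (y : ι → ℝ) : ℝ :=
  ∑ s : Finset ι, tauCoeff u s * ∏ k ∈ s, y k

theorem tau_ofReal {u : ι → ℂ} (hu : ∀ i k, conj (u i) ≠ u k) (y : ι → ℝ) :
    tau u (fun k => (y k : ℂ)) = realTau u y := by
  rw [tau_eq_sum hu, realTau]
  push_cast
  rfl

omit [Fintype ι] in
theorem term_nonneg {u : ι → ℂ} (hu : ∀ i k, conj (u i) ≠ u k) {y : ι → ℝ} (hy : ∀ k, 0 < y k)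
    (s : Finset ι) : 0 ≤ tauCoeff u s * ∏ k ∈ s, y k :=
  mul_nonneg (tauCoeff_spec hu s).1 (Finset.prod_nonneg fun k _ => (hy k).le)

theorem term_le_realTau {u : ι → ℂ} (hu : ∀ i k, conj (u i) ≠ u k) {y : ι → ℝ} (hy : ∀ k, 0 < y k)
    (s : Finset ι) : tauCoeff u s * ∏ k ∈ s, y k ≤ realTau u y :=
  Finset.single_le_sum (f := fun s => tauCoeff u s * ∏ k ∈ s, y k)
    (fun s _ => term_nonneg hu hy s) (Finset.mem_univ s)

omit [Fintype ι] in
theorem tauCoeff_pos {u : ι → ℂ} (hu : ∀ i k, conj (u i) ≠ u k) {s : Finset ι}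
    (hs : Set.InjOn u s) : 0 < tauCoeff u s :=
  lt_of_le_of_ne (tauCoeff_spec hu s).1 ((tauCoeff_spec hu s).2.1.mpr hs).symm

theorem realTau_pos {u : ι → ℂ} (hu : ∀ i k, conj (u i) ≠ u k) {y : ι → ℝ} (hy : ∀ k, 0 < y k) :
    0 < realTau u y := by
  refine lt_of_lt_of_le ?_ (term_le_realTau hu hy ∅)
  simpa using tauCoeff_pos hu (s := ∅) (by simp)

theorem norm_add_mul_lt {a b : ℝ} (ha : 0 < a) (hb : 0 < b) {ρ : ℂ} (hρ : ‖ρ‖ = 1) (h1 : ρ ≠ 1) :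
    ‖(a : ℂ) + b * ρ‖ < a + b := by
  have hsq : ρ.re * ρ.re + ρ.im * ρ.im = 1 := by
    rw [← Complex.normSq_apply, Complex.normSq_eq_norm_sq, hρ, one_pow]
  have hre : ρ.re < 1 := by
    refine lt_of_le_of_ne (hρ ▸ Complex.re_le_norm ρ) fun h => h1 ?_
    rw [h] at hsq
    exact Complex.ext h (by simpa using hsq)
  refine lt_of_pow_lt_pow_left₀ 2 (by positivity) ?_
  rw [← Complex.normSq_eq_norm_sq, Complex.normSq_apply]
  simp only [Complex.add_re, Complex.add_im, Complex.mul_re, Complex.mul_im, Complex.ofReal_re,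
    Complex.ofReal_im, zero_mul, sub_zero, add_zero, zero_add]
  have hid : (a + b * ρ.re) * (a + b * ρ.re) + b * ρ.im * (b * ρ.im) =
      (a + b) ^ 2 - 2 * (a * b * (1 - ρ.re)) := by
    linear_combination b ^ 2 * hsq
  have := mul_pos (mul_pos ha hb) (sub_pos.mpr hre)
  linarith

/-- Multiplying the arguments by unimodular phases that are not all `1` strictly decreases the
modulus of the tau function: the terms `1` and `y k` of the expansion stop being aligned. -/
theorem norm_tau_phase_lt {u : ι → ℂ} (hu : ∀ i k, conj (u i) ≠ u k) {y : ι → ℝ}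
    (hy : ∀ k, 0 < y k) {ρ : ι → ℂ} (hρ : ∀ k, ‖ρ k‖ = 1) {k₀ : ι} (hk₀ : ρ k₀ ≠ 1) :
    ‖tau u (fun k => ρ k * y k)‖ < realTau u y := by
  set c : Finset ι → ℝ := fun s => tauCoeff u s * ∏ k ∈ s, y k with hc
  have hc0 : ∀ s, 0 ≤ c s := term_nonneg hu hy
  have hpos : ∀ s : Finset ι, Set.InjOn u s → 0 < c s := fun s hs =>
    mul_pos (tauCoeff_pos hu hs) (Finset.prod_pos fun k _ => hy k)
  have hexp : tau u (fun k => ρ k * y k) = ∑ s, (c s : ℂ) * ∏ k ∈ s, ρ k := by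
    rw [tau_eq_sum hu]
    refine Finset.sum_congr rfl fun s _ => ?_
    rw [Finset.prod_mul_distrib, hc]
    push_cast
    ring
  have hnorm : ∀ s, ‖(c s : ℂ) * ∏ k ∈ s, ρ k‖ = c s := fun s => by
    rw [norm_mul, norm_prod, Finset.prod_congr rfl fun k _ => hρ k, Finset.prod_const_one, mul_one,
      Complex.norm_real, Real.norm_of_nonneg (hc0 s)]
  have hne : (∅ : Finset ι) ≠ {k₀} := (Finset.singleton_ne_empty k₀).symm
  have hsplit : ∀ {R : Type} [AddCommMonoid R] (f : Finset ι → R),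
      ∑ s, f s = (f ∅ + f {k₀}) + ∑ s ∈ ({∅, {k₀}} : Finset (Finset ι))ᶜ, f s := by
    intro R _ f
    rw [← Finset.sum_pair hne, Finset.sum_add_sum_compl]
  rw [hexp, hsplit, realTau, hsplit (fun s => tauCoeff u s * ∏ k ∈ s, y k)]
  refine (norm_add_le _ _).trans_lt (add_lt_add_of_lt_of_le ?_ ?_)
  · have h := norm_add_mul_lt (hpos ∅ (by simp)) (hpos {k₀} (by simp)) (hρ k₀) hk₀
    change _ < c ∅ + c {k₀}
    simpa using h
  · refine (norm_sum_le _ _).trans (Finset.sum_le_sum fun s _ => (hnorm s).le)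

/-- Along a filter on which each argument tends to `0` or to `∞`, according to the point it belongs
to, the ratio of the tau function with and without unimodular phases has modulus tending to `1`:
all dominant terms carry the same phase, the product over the growing points. -/
theorem tendsto_norm_tau_phase_div {u : ι → ℂ} (hu : ∀ i k, conj (u i) ≠ u k) {l : Filter ℝ}
    {y : ℝ → ι → ℝ} (hy : ∀ x k, 0 < y x k) (G : Set ℂ)
    (hG : ∀ k, u k ∈ G → Tendsto (fun x => y x k) l atTop)
    (hG' : ∀ k, u k ∉ G → Tendsto (fun x => y x k) l (nhds 0))
    {ρ : ℂ → ℂ} (hρ : ∀ k, ‖ρ (u k)‖ = 1) :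
    Tendsto (fun x => ‖tau u (fun k => ρ (u k) * y x k) / realTau u (y x)‖) l (nhds 1) := by
  classical
  set gr : Finset ℂ := (Finset.univ.image u).filter (· ∈ G) with hgr
  set φ₀ : ℂ := ∏ z ∈ gr, ρ z with hphase
  have hphase_norm : ‖φ₀‖ = 1 := by
    rw [hphase, norm_prod]
    refine Finset.prod_eq_one fun z hz => ?_
    obtain ⟨k, -, rfl⟩ := Finset.mem_image.mp (Finset.mem_filter.mp hz).1
    exact hρ k
  suffices h : Tendsto (fun x => tau u (fun k => ρ (u k) * y x k) / realTau u (y x)) l (nhds φ₀) by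
    simpa [hphase_norm] using h.norm
  have hpos : ∀ x, 0 < realTau u (y x) := fun x => realTau_pos hu (hy x)
  have hkey : ∀ s : Finset ι, Tendsto (fun x => ((∏ k ∈ s, ρ (u k)) - φ₀) *
      ((tauCoeff u s * (∏ k ∈ s, y x k) / realTau u (y x) : ℝ) : ℂ)) l (nhds 0) := by
    intro s
    by_cases hs : Set.InjOn u s
    swap
    · have : tauCoeff u s = 0 := by
        by_contra h
        exact hs ((tauCoeff_spec hu s).2.1.mp h)
      simpa [this] using tendsto_const_nhds
    have hsuff : ∀ g : ℝ → ℝ, Tendsto g l (nhds 0) →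
        (∀ x, tauCoeff u s * (∏ k ∈ s, y x k) ≤ g x * realTau u (y x)) →
        Tendsto (fun x => ((∏ k ∈ s, ρ (u k)) - φ₀) *
          ((tauCoeff u s * (∏ k ∈ s, y x k) / realTau u (y x) : ℝ) : ℂ)) l (nhds 0) := by
      intro g hg hle
      have h1 : Tendsto (fun x => tauCoeff u s * (∏ k ∈ s, y x k) / realTau u (y x)) l (nhds 0) :=
        squeeze_zero (fun x => div_nonneg (term_nonneg hu (hy x) s) (hpos x).le)
          (fun x => (div_le_iff₀ (hpos x)).mpr (hle x)) hg
      have h2 := (Complex.continuous_ofReal.tendsto 0).comp h1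
      simpa using h2.const_mul ((∏ k ∈ s, ρ (u k)) - φ₀)
    by_cases hdec : ∃ k ∈ s, u k ∉ G
    -- A decaying factor may be removed from the term.
    · obtain ⟨k, hks, hkG⟩ := hdec
      have hinj : Set.InjOn u (s.erase k) := hs.mono (Finset.coe_subset.mpr (s.erase_subset k))
      have hc := tauCoeff_pos hu hinj
      refine hsuff (fun x => tauCoeff u s / tauCoeff u (s.erase k) * y x k) ?_ fun x => ?_
      · simpa using (hG' k hkG).const_mul (tauCoeff u s / tauCoeff u (s.erase k))
      · have h1 := term_le_realTau hu (hy x) (s.erase k)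
        rw [← Finset.mul_prod_erase s (fun k => y x k) hks]
        have h2 : 0 ≤ tauCoeff u s / tauCoeff u (s.erase k) * y x k :=
          mul_nonneg (div_nonneg (tauCoeff_spec hu s).1 hc.le) (hy x k).le
        refine le_trans (le_of_eq ?_) (mul_le_mul_of_nonneg_left h1 h2)
        field_simp
    push Not at hdec
    by_cases hmiss : ∃ k, u k ∈ G ∧ ∀ i ∈ s, u i ≠ u k
    -- A growing point that is not represented may be added to the term.
    · obtain ⟨k, hkG, hkn⟩ := hmiss
      have hks : k ∉ s := fun h => hkn k h rfl
      have hinj : Set.InjOn u (insert k s : Finset ι) := by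
        rw [Finset.coe_insert, Set.injOn_insert (by simpa using hks)]
        exact ⟨hs, by rintro ⟨i, hi, hik⟩; exact hkn i hi hik⟩
      have hc := tauCoeff_pos hu hinj
      refine hsuff (fun x => tauCoeff u s / tauCoeff u (insert k s) * (y x k)⁻¹) ?_ fun x => ?_
      · simpa using (hG k hkG).inv_tendsto_atTop.const_mul
          (tauCoeff u s / tauCoeff u (insert k s))
      · have h1 := term_le_realTau hu (hy x) (insert k s)
        rw [Finset.prod_insert hks] at h1
        have hyk := hy x k
        have h2 : 0 ≤ tauCoeff u s / tauCoeff u (insert k s) * (y x k)⁻¹ :=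
          mul_nonneg (div_nonneg (tauCoeff_spec hu s).1 hc.le) (inv_nonneg.mpr hyk.le)
        refine le_trans (le_of_eq ?_) (mul_le_mul_of_nonneg_left h1 h2)
        field_simp
    -- Otherwise the term represents each growing point exactly once and has phase `φ₀`.
    push Not at hmiss
    have himg : s.image u = gr := by
      ext z
      simp only [hgr, Finset.mem_image, Finset.mem_filter, Finset.mem_univ, true_and]
      constructor
      · rintro ⟨k, hk, rfl⟩
        exact ⟨⟨k, rfl⟩, hdec k hk⟩
      · rintro ⟨⟨k, rfl⟩, hk⟩
        exact hmiss k hk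
    have : ∏ k ∈ s, ρ (u k) = φ₀ := by
      rw [hphase, ← himg, Finset.prod_image fun i hi k hk h => hs hi hk h]
    simpa [this] using tendsto_const_nhds
  have hsum := tendsto_finsetSum Finset.univ fun s _ => hkey s
  rw [Finset.sum_const_zero] at hsum
  have hlim := hsum.add_const φ₀
  rw [zero_add] at hlim
  refine hlim.congr fun x => ?_
  have h0 : (realTau u (y x) : ℂ) ≠ 0 := Complex.ofReal_ne_zero.mpr (hpos x).ne'
  have hτ : (realTau u (y x) : ℂ) =
      ∑ s : Finset ι, (tauCoeff u s : ℂ) * ∏ k ∈ s, (y x k : ℂ) := by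
    rw [realTau]
    push_cast
    rfl
  rw [eq_div_iff h0, add_mul, Finset.sum_mul]
  conv_lhs =>
    enter [2]
    rw [hτ]
  rw [Finset.mul_sum, ← Finset.sum_add_distrib, tau_eq_sum hu]
  refine Finset.sum_congr rfl fun s _ => ?_
  rw [Finset.prod_mul_distrib]
  push_cast
  field_simp
  ring

/-! ### Brackets and their derivatives -/

section Bracket

/-- The bracket `⟨g, f⟩ = (gβ)ᵀ M⁻¹ (αf)`, with pointwise products of vectors. The vectors `α`, `β`
are fixed solutions of the free equations and `g`, `f` are constant multipliers, so that
differentiating `α` or `β` again produces brackets. -/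
noncomputable def bracket (M : Matrix ι ι ℂ) (α β g f : ι → ℂ) : ℂ :=
  (g * β) ⬝ᵥ (M⁻¹ *ᵥ (f * α))

variable (M : Matrix ι ι ℂ) (α β : ι → ℂ)

theorem bracket_add_left (g g' f : ι → ℂ) :
    bracket M α β (g + g') f = bracket M α β g f + bracket M α β g' f := by
  simp [bracket, add_mul, add_dotProduct]

theorem bracket_add_right (g f f' : ι → ℂ) :
    bracket M α β g (f + f') = bracket M α β g f + bracket M α β g f' := by
  simp [bracket, add_mul, mulVec_add, dotProduct_add]

theorem bracket_smul_left (c : ℂ) (g f : ι → ℂ) :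
    bracket M α β (c • g) f = c * bracket M α β g f := by
  simp [bracket]

theorem bracket_smul_right (c : ℂ) (g f : ι → ℂ) :
    bracket M α β g (c • f) = c * bracket M α β g f := by
  simp [bracket, mulVec_smul]

theorem bracket_eq_sum (g f : ι → ℂ) :
    bracket M α β g f = ∑ k, ∑ i, g k * β k * M⁻¹ k i * (f i * α i) := by
  simp [bracket, dotProduct, mulVec, Finset.mul_sum, mul_assoc]

end Bracket

theorem differentiableAt_det {M : ℝ → Matrix ι ι ℂ} {s : ℝ}
    (hM : ∀ i k, DifferentiableAt ℝ (fun s => M s i k) s) :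
    DifferentiableAt ℝ (fun s => (M s).det) s := by
  simp only [det_apply]
  refine DifferentiableAt.fun_sum fun σ _ => DifferentiableAt.const_smul ?_ _
  exact DifferentiableAt.fun_finsetProd fun i _ => hM _ _

/-- Derivative of the entries of an inverse matrix: `(M⁻¹)' = -M⁻¹ M' M⁻¹`. -/
theorem hasDerivAt_inv_apply {M : ℝ → Matrix ι ι ℂ} {M' : Matrix ι ι ℂ} {s : ℝ}
    (hM : ∀ i k, HasDerivAt (fun s => M s i k) (M' i k) s) (hdet : ∀ s, (M s).det ≠ 0) (i k : ι) :
    HasDerivAt (fun s => (M s)⁻¹ i k) (-((M s)⁻¹ * M' * (M s)⁻¹) i k) s := by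
  have hdiff : ∀ i k, DifferentiableAt ℝ (fun s => (M s)⁻¹ i k) s := by
    intro i k
    have hadj : DifferentiableAt ℝ (fun s => (M s).adjugate i k) s := by
      simp only [adjugate_apply]
      refine differentiableAt_det fun a b => ?_
      by_cases h : a = k
      · subst h
        simp
      · simpa [updateRow_ne h] using (hM a b).differentiableAt
    have hd := (differentiableAt_det fun i k => (hM i k).differentiableAt).inv (hdet s)
    refine (hd.mul hadj).congr_of_eventuallyEq (Filter.Eventually.of_forall fun s => ?_)
    simp [inv_def]
  set R' : Matrix ι ι ℂ := of fun i k => deriv (fun s => (M s)⁻¹ i k) s with hR'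
  have hR : ∀ i k, HasDerivAt (fun s => (M s)⁻¹ i k) (R' i k) s := fun i k =>
    (hdiff i k).hasDerivAt
  have hunit : ∀ s, IsUnit (M s).det := fun s => isUnit_iff_ne_zero.mpr (hdet s)
  -- Differentiating `M M⁻¹ = 1` determines the derivative of `M⁻¹`.
  have hprod : M' * (M s)⁻¹ + M s * R' = 0 := by
    ext i k
    have h1 : HasDerivAt (fun s => ∑ j, M s i j * (M s)⁻¹ j k)
        (∑ j, (M' i j * (M s)⁻¹ j k + M s i j * R' j k)) s :=
      HasDerivAt.fun_sum fun j _ => (hM i j).mul (hR j k)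
    have h2 : (fun s => ∑ j, M s i j * (M s)⁻¹ j k) = fun _ => (1 : Matrix ι ι ℂ) i k := by
      funext s
      rw [← mul_apply, mul_nonsing_inv _ (hunit s)]
    rw [h2] at h1
    have h3 := h1.unique (hasDerivAt_const s _)
    rw [Matrix.add_apply, mul_apply, mul_apply, ← Finset.sum_add_distrib, h3, Matrix.zero_apply]
  have : R' = -((M s)⁻¹ * M' * (M s)⁻¹) := by
    have h := congrArg (fun X => (M s)⁻¹ * X) hprod
    simp only [mul_add, mul_zero] at h
    rw [nonsing_inv_mul_cancel_left _ _ (hunit s), ← mul_assoc] at h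
    exact eq_neg_of_add_eq_zero_right h
  rw [← Matrix.neg_apply, ← this]
  exact hR i k

/-- Derivative of the bracket for a matrix `M` depending on a parameter, when the derivative of `M`
is the sum of two matrices of rank one and `α`, `β` are eigenvectors of differentiation
componentwise. -/
theorem hasDerivAt_bracket {M : ℝ → Matrix ι ι ℂ} {α β : ℝ → ι → ℂ} {s : ℝ}
    {p p' m m' : ι → ℂ} (a b : ι → ℂ) (c : ℂ)
    (hM : ∀ i k, HasDerivAt (fun s => M s i k)
      (p i * α s i * (m k * β s k) + c * (p' i * α s i) * (m' k * β s k)) s)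
    (hdet : ∀ s, (M s).det ≠ 0)
    (hα : ∀ i, HasDerivAt (fun s => α s i) (a i * α s i) s)
    (hβ : ∀ k, HasDerivAt (fun s => β s k) (b k * β s k) s)
    (g f : ι → ℂ) :
    HasDerivAt (fun s => bracket (M s) (α s) (β s) g f)
      (bracket (M s) (α s) (β s) (g * b) f + bracket (M s) (α s) (β s) g (f * a)
        - bracket (M s) (α s) (β s) g p * bracket (M s) (α s) (β s) m f
        - c * bracket (M s) (α s) (β s) g p' * bracket (M s) (α s) (β s) m' f) s := by
  set R := (M s)⁻¹ with hR
  set M' : Matrix ι ι ℂ := vecMulVec (p * α s) (m * β s) + c • vecMulVec (p' * α s) (m' * β s)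
    with hM'
  have hinv := hasDerivAt_inv_apply (M' := M')
    (fun i k => (hM i k).congr_deriv (by simp [hM', vecMulVec_apply, mul_assoc])) hdet
  have h1 : HasDerivAt (fun s => bracket (M s) (α s) (β s) g f)
      (∑ k, ∑ i, ((g k * (b k * β s k) * R k i + g k * β s k * (-(R * M' * R) k i)) * (f i * α s i)
        + g k * β s k * R k i * (f i * (a i * α s i)))) s := by
    simp only [bracket_eq_sum]
    exact HasDerivAt.fun_sum fun k _ => HasDerivAt.fun_sum fun i _ =>
      (((hβ k).const_mul (g k)).mul (hinv k i)).mul ((hα i).const_mul (f i))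
  refine h1.congr_deriv ?_
  have h2 : R * M' * R = vecMulVec (R *ᵥ (p * α s)) ((m * β s) ᵥ* R)
      + c • vecMulVec (R *ᵥ (p' * α s)) ((m' * β s) ᵥ* R) := by
    rw [hM', mul_add, add_mul, mul_smul_comm, smul_mul_assoc, mul_vecMulVec, vecMulVec_mul,
      mul_vecMulVec, vecMulVec_mul]
  have h3 : ∀ (p m : ι → ℂ), bracket (M s) (α s) (β s) g p * bracket (M s) (α s) (β s) m f =
      ∑ k, ∑ i, g k * β s k * vecMulVec (R *ᵥ (p * α s)) ((m * β s) ᵥ* R) k i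
        * (f i * α s i) := by
    intro p m
    rw [bracket, bracket, ← hR, dotProduct_mulVec (m * β s), dotProduct, dotProduct,
      Finset.sum_mul_sum]
    refine Finset.sum_congr rfl fun k _ => Finset.sum_congr rfl fun i _ => ?_
    simp only [vecMulVec_apply, Pi.mul_apply]
    ring
  rw [mul_assoc c, h3, h3, bracket_eq_sum, bracket_eq_sum, Finset.mul_sum,
    ← Finset.sum_add_distrib, ← Finset.sum_sub_distrib, ← Finset.sum_sub_distrib]
  refine Finset.sum_congr rfl fun k _ => ?_
  rw [Finset.mul_sum, ← Finset.sum_add_distrib, ← Finset.sum_sub_distrib, ← Finset.sum_sub_distrib]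
  refine Finset.sum_congr rfl fun i _ => ?_
  rw [h2]
  simp only [Matrix.add_apply, Matrix.smul_apply, smul_eq_mul, Pi.mul_apply, ← hR]
  ring

/-! ### The algebra of the dressed matrix -/

section Algebra

variable {M : Matrix ι ι ℂ} {α β l l' : ι → ℂ}

/-- The bracket with the additional weight `M⁻¹ (diag l' - diag l) M⁻¹`. -/
noncomputable def weightedBracket (M : Matrix ι ι ℂ) (α β l l' g f : ι → ℂ) : ℂ :=
  (g * β) ⬝ᵥ ((M⁻¹ * diagonal (l' - l) * M⁻¹) *ᵥ (f * α))

/-- `M` solves the Sylvester-type equation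
`diag l' · M - M · diag l = diag (l' - l) - i α βᵀ`. -/
def IsDressed (M : Matrix ι ι ℂ) (α β l l' : ι → ℂ) : Prop :=
  diagonal l' * M - M * diagonal l = diagonal (l' - l) - Complex.I • vecMulVec α β

/-- A product of brackets reduces to single brackets because `M⁻¹ α βᵀ M⁻¹` is, up to the weight,
the commutator of `M⁻¹` with the diagonal matrices. -/
theorem bracket_mul_bracket (hM : IsDressed M α β l l') (hdet : M.det ≠ 0) (g f : ι → ℂ) :
    bracket M α β g 1 * bracket M α β 1 f =
      Complex.I * (bracket M α β g (l' * f) - bracket M α β (l * g) f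
        - weightedBracket M α β l l' g f) := by
  have hu : IsUnit M.det := isUnit_iff_ne_zero.mpr hdet
  have h1 : M⁻¹ * vecMulVec α β * M⁻¹ = Complex.I •
      (M⁻¹ * diagonal l' - diagonal l * M⁻¹ - M⁻¹ * diagonal (l' - l) * M⁻¹) := by
    have h2 : vecMulVec α β = Complex.I •
        (diagonal l' * M - M * diagonal l - diagonal (l' - l)) := by
      rw [hM, sub_sub_cancel_left, smul_neg, smul_smul, Complex.I_mul_I, neg_one_smul, neg_neg]
    rw [h2, mul_smul_comm, smul_mul_assoc, mul_sub, mul_sub, sub_mul, sub_mul, ← mul_assoc,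
      mul_assoc (M⁻¹ * diagonal l'), mul_nonsing_inv _ hu, mul_one, ← mul_assoc,
      nonsing_inv_mul _ hu, one_mul]
  have h3 : bracket M α β g 1 * bracket M α β 1 f =
      (g * β) ⬝ᵥ ((M⁻¹ * vecMulVec α β * M⁻¹) *ᵥ (f * α)) := by
    rw [mul_vecMulVec, vecMulVec_mul, vecMulVec_mulVec, bracket, bracket, one_mul, one_mul,
      dotProduct_mulVec β]
    simp [mul_comm]
  rw [h3, h1, smul_mulVec, sub_mulVec, sub_mulVec, dotProduct_smul, dotProduct_sub,
    dotProduct_sub, smul_eq_mul, ← mulVec_mulVec, ← mulVec_mulVec, bracket, bracket,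
    weightedBracket]
  have h4 : diagonal l' *ᵥ (f * α) = l' * f * α := by
    ext i
    simp [mulVec_diagonal, mul_assoc]
  have h5 : (g * β) ⬝ᵥ (diagonal l *ᵥ (M⁻¹ *ᵥ (f * α))) = (l * g * β) ⬝ᵥ (M⁻¹ *ᵥ (f * α)) := by
    simp only [dotProduct, mulVec_diagonal, Pi.mul_apply]
    exact Finset.sum_congr rfl fun i _ => by ring
  rw [h4, h5]

end Algebra

/-! ### The reduction -/

section Reduction

variable {M : Matrix ι ι ℂ} {α β l l' : ι → ℂ}

theorem IsDressed.mul_eq (hM : IsDressed M α β l l') (a b : ι) :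
    α b * β a = Complex.I * ((l' b - l a) * M b a - if b = a then l' b - l b else 0) := by
  have h := congrFun (congrFun hM b) a
  simp only [Matrix.sub_apply, diagonal_mul, mul_diagonal, diagonal_apply, Matrix.smul_apply,
    vecMulVec_apply, smul_eq_mul, Pi.sub_apply] at h
  linear_combination (-Complex.I) * h + α b * β a * Complex.I_mul_I

/-- The matrix `M⁻¹ D M⁻¹` with `D` diagonal pairs to zero with every commutator of `M` with a
diagonal matrix. -/
theorem sum_commutator_eq_zero (hdet : M.det ≠ 0) (D P : ι → ℂ) :
    ∑ a, ∑ b, (M⁻¹ * diagonal D * M⁻¹) a b * ((P a - P b) * M b a) = 0 := by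
  have hu : IsUnit M.det := isUnit_iff_ne_zero.mpr hdet
  have h1 : ∑ a, ∑ b, (M⁻¹ * diagonal D * M⁻¹) a b * ((P a - P b) * M b a) =
      trace (M⁻¹ * diagonal D * M⁻¹ * (M * diagonal P - diagonal P * M)) := by
    rw [trace]
    refine Finset.sum_congr rfl fun a _ => ?_
    rw [diag_apply, mul_apply]
    refine Finset.sum_congr rfl fun b _ => ?_
    rw [Matrix.sub_apply, mul_diagonal, diagonal_mul]
    ring
  have h2 : M⁻¹ * diagonal D * M⁻¹ * (M * diagonal P) = M⁻¹ * (diagonal D * diagonal P) := by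
    rw [← mul_assoc, mul_assoc (M⁻¹ * diagonal D), nonsing_inv_mul _ hu, mul_one, mul_assoc]
  have h3 : trace (M⁻¹ * diagonal D * M⁻¹ * (diagonal P * M)) =
      trace (M⁻¹ * (diagonal P * diagonal D)) := by
    rw [← mul_assoc, trace_mul_comm, mul_assoc, mul_assoc, ← mul_assoc M, mul_nonsing_inv _ hu,
      one_mul, trace_mul_comm, mul_assoc]
  rw [h1, mul_sub, trace_sub, h2, h3, diagonal_mul_diagonal, diagonal_mul_diagonal, sub_eq_zero]
  simp only [mul_comm (D _)]

variable {J : Type} [Fintype J] {e q : J → ℂ}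

/-- The reduction: under the condition `∑ q / ((l + e) (l' + e)) = -1` the weighted sum of the
products of the two dressed functions is the weighted bracket `⟨1, 1⟩`, which is the `x`-derivative
of the bracket `⟨1, 1⟩`. -/
theorem sum_mul_sub_one (hM : IsDressed M α β l l') (hdet : M.det ≠ 0)
    (hl : ∀ k j, l k + e j ≠ 0) (hl' : ∀ k j, l' k + e j ≠ 0)
    (hq : ∀ k, 1 + ∑ j, q j / ((l k + e j) * (l' k + e j)) = 0) :
    ∑ j, q j * ((1 - Complex.I * bracket M α β (fun k => (l k + e j)⁻¹) 1)
        * (1 + Complex.I * bracket M α β 1 (fun k => (l' k + e j)⁻¹)) - 1) =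
      Complex.I * weightedBracket M α β l l' 1 1 := by
  have h1 : ∀ j, (1 - Complex.I * bracket M α β (fun k => (l k + e j)⁻¹) 1)
        * (1 + Complex.I * bracket M α β 1 (fun k => (l' k + e j)⁻¹)) - 1 =
      -(Complex.I * weightedBracket M α β l l' (fun k => (l k + e j)⁻¹)
        (fun k => (l' k + e j)⁻¹)) := by
    intro j
    have h2 := bracket_mul_bracket hM hdet (fun k => (l k + e j)⁻¹) (fun k => (l' k + e j)⁻¹)
    have h3 : l' * (fun k => (l' k + e j)⁻¹) = 1 + (-e j) • (fun k => (l' k + e j)⁻¹) := by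
      funext k
      have := hl' k j
      simp only [Pi.mul_apply, Pi.add_apply, Pi.one_apply, Pi.smul_apply, smul_eq_mul]
      field_simp
      ring
    have h4 : l * (fun k => (l k + e j)⁻¹) = 1 + (-e j) • (fun k => (l k + e j)⁻¹) := by
      funext k
      have := hl k j
      simp only [Pi.mul_apply, Pi.add_apply, Pi.one_apply, Pi.smul_apply, smul_eq_mul]
      field_simp
      ring
    rw [h3, h4, bracket_add_right, bracket_add_left, bracket_smul_right, bracket_smul_left] at h2
    linear_combination h2 - bracket M α β (fun k => (l k + e j)⁻¹) 1 *
      bracket M α β 1 (fun k => (l' k + e j)⁻¹) * Complex.I_mul_I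
  set X := M⁻¹ * diagonal (l' - l) * M⁻¹ with hX
  have hw : ∀ g f : ι → ℂ, weightedBracket M α β l l' g f =
      ∑ a, ∑ b, X a b * (g a * f b * (α b * β a)) := by
    intro g f
    simp only [weightedBracket, ← hX, dotProduct, mulVec, Finset.mul_sum, Pi.mul_apply]
    exact Finset.sum_congr rfl fun a _ => Finset.sum_congr rfl fun b _ => by ring
  -- By partial fractions the condition says that `P` takes the same value at `l k` and `l' k`.
  set P : ι → ℂ := fun k => ∑ j, q j / (l k + e j) - l k with hP
  have hPP : ∀ a b, (∑ j, q j * ((l a + e j)⁻¹ * (l' b + e j)⁻¹)) * (l' b - l a) =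
      P a - P b - (l' b - l a) := by
    intro a b
    have hpart : ∀ a b, (∑ j, q j * ((l a + e j)⁻¹ * (l' b + e j)⁻¹)) * (l' b - l a) =
        ∑ j, q j / (l a + e j) - ∑ j, q j / (l' b + e j) := by
      intro a b
      rw [Finset.sum_mul, ← Finset.sum_sub_distrib]
      refine Finset.sum_congr rfl fun j _ => ?_
      have := hl a j
      have := hl' b j
      field_simp
      ring
    have hb : (∑ j, q j * ((l b + e j)⁻¹ * (l' b + e j)⁻¹)) = -1 := by
      rw [eq_neg_iff_add_eq_zero, add_comm, ← hq b]
      simp only [div_eq_mul_inv, mul_inv]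
    have h5 := hpart b b
    rw [hb] at h5
    rw [hpart a b]
    linear_combination -h5
  have hsum : ∑ j, q j * weightedBracket M α β l l' (fun k => (l k + e j)⁻¹)
        (fun k => (l' k + e j)⁻¹) = -weightedBracket M α β l l' 1 1 := by
    have h6 := sum_commutator_eq_zero hdet (l' - l) P
    rw [← hX] at h6
    simp only [hw]
    have h7 : ∀ a b, (∑ j, q j * ((l a + e j)⁻¹ * (l' b + e j)⁻¹)) * (α b * β a) =
        Complex.I * ((P a - P b) * M b a) - α b * β a := by
      intro a b
      have h8 := hPP a b
      rw [hM.mul_eq]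
      split_ifs with hba
      · subst hba
        linear_combination (Complex.I * (M b b - 1)) * h8
      · linear_combination (Complex.I * M b a) * h8
    have h9 : ∑ j, q j * ∑ a, ∑ b, X a b * ((l a + e j)⁻¹ * (l' b + e j)⁻¹ * (α b * β a)) =
        ∑ a, ∑ b, X a b * ((∑ j, q j * ((l a + e j)⁻¹ * (l' b + e j)⁻¹)) * (α b * β a)) := by
      simp only [Finset.mul_sum, Finset.sum_mul]
      rw [Finset.sum_comm]
      refine Finset.sum_congr rfl fun a _ => ?_
      rw [Finset.sum_comm]
      exact Finset.sum_congr rfl fun b _ => Finset.sum_congr rfl fun j _ => by ring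
    rw [h9]
    have h10 : ∑ a, ∑ b, X a b * ((∑ j, q j * ((l a + e j)⁻¹ * (l' b + e j)⁻¹)) * (α b * β a)) =
        Complex.I * ∑ a, ∑ b, X a b * ((P a - P b) * M b a)
          - ∑ a, ∑ b, X a b * ((1 : ι → ℂ) a * (1 : ι → ℂ) b * (α b * β a)) := by
      simp only [Finset.mul_sum Finset.univ _ Complex.I, ← Finset.sum_sub_distrib]
      refine Finset.sum_congr rfl fun a _ => Finset.sum_congr rfl fun b _ => ?_
      rw [h7, Pi.one_apply, Pi.one_apply]
      ring
    rw [h10, h6, mul_zero, zero_sub]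
  simp only [h1]
  rw [Finset.sum_congr rfl fun j _ => show q j * -(Complex.I * weightedBracket M α β l l'
    (fun k => (l k + e j)⁻¹) (fun k => (l' k + e j)⁻¹)) = -Complex.I * (q j *
    weightedBracket M α β l l' (fun k => (l k + e j)⁻¹) (fun k => (l' k + e j)⁻¹)) by ring,
    ← Finset.mul_sum, hsum]
  ring

end Reduction

/-! ### The evolution of the dressed matrix -/

section Evolution

/-- The phase `i z x - i z² t` of the free exponential solution with spectral parameter `z`. -/
noncomputable def phase (z : ℂ) (x t : ℝ) : ℂ :=
  Complex.I * z * x - Complex.I * z ^ 2 * t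

/-- The left vector `αᵢ = i cᵢ exp (phase l'ᵢ)`. -/
noncomputable def leftVec (c l' : ι → ℂ) (x t : ℝ) (i : ι) : ℂ :=
  Complex.I * c i * Complex.exp (phase (l' i) x t)

/-- The right vector `βₖ = exp (-phase lₖ)`. -/
noncomputable def rightVec (l : ι → ℂ) (x t : ℝ) (k : ι) : ℂ :=
  Complex.exp (-phase (l k) x t)

/-- The dressed matrix `1 - i αᵢ βₖ / (l'ᵢ - lₖ)`. -/
noncomputable def dressedMatrix (c l l' : ι → ℂ) (x t : ℝ) : Matrix ι ι ℂ :=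
  of fun i k => (if i = k then 1 else 0) -
    Complex.I * (leftVec c l' x t i * rightVec l x t k) / (l' i - l k)

/-- The bracket of the dressed matrix as a function of `x` and `t`. -/
noncomputable def dressedBracket (c l l' g f : ι → ℂ) (x t : ℝ) : ℂ :=
  bracket (dressedMatrix c l l' x t) (leftVec c l' x t) (rightVec l x t) g f

theorem hasDerivAt_phase_x (z : ℂ) (x t : ℝ) :
    HasDerivAt (fun x : ℝ => phase z x t) (Complex.I * z) x := by
  have h := ((Complex.ofRealCLM.hasDerivAt (x := x)).const_mul (Complex.I * z)).sub_const
    (Complex.I * z ^ 2 * t)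
  simpa [phase] using h

theorem hasDerivAt_phase_t (z : ℂ) (x t : ℝ) :
    HasDerivAt (fun t : ℝ => phase z x t) (-(Complex.I * z ^ 2)) t := by
  have h := ((Complex.ofRealCLM.hasDerivAt (x := t)).const_mul (Complex.I * z ^ 2)).const_sub
    (Complex.I * z * x)
  simpa [phase] using h

variable {c l l' : ι → ℂ}

theorem isDressed_dressedMatrix (hne : ∀ i k, l' i ≠ l k) (x t : ℝ) :
    IsDressed (dressedMatrix c l l' x t) (leftVec c l' x t) (rightVec l x t) l l' := by
  unfold IsDressed
  ext i k
  have := sub_ne_zero.mpr (hne i k)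
  simp only [Matrix.sub_apply, diagonal_mul, mul_diagonal, diagonal_apply, Matrix.smul_apply,
    vecMulVec_apply, smul_eq_mul, Pi.sub_apply, dressedMatrix, of_apply]
  split_ifs with h
  · subst h
    field_simp
  · field_simp
    ring

theorem hasDerivAt_dressedBracket_x (hne : ∀ i k, l' i ≠ l k)
    (hdet : ∀ x t, (dressedMatrix c l l' x t).det ≠ 0) (g f : ι → ℂ) (x t : ℝ) :
    HasDerivAt (fun x => dressedBracket c l l' g f x t)
      (-Complex.I * dressedBracket c l l' (l * g) f x t
        + Complex.I * dressedBracket c l l' g (l' * f) x t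
        - dressedBracket c l l' g 1 x t * dressedBracket c l l' 1 f x t) x := by
  have hα : ∀ i, HasDerivAt (fun x => leftVec c l' x t i)
      (Complex.I * l' i * leftVec c l' x t i) x := fun i =>
    (((hasDerivAt_phase_x (l' i) x t).cexp).const_mul (Complex.I * c i)).congr_deriv (by
      rw [leftVec]; ring)
  have hβ : ∀ k, HasDerivAt (fun x => rightVec l x t k)
      (-(Complex.I * l k) * rightVec l x t k) x := fun k =>
    ((hasDerivAt_phase_x (l k) x t).neg.cexp).congr_deriv (by
      simp only [rightVec, Pi.neg_apply]; ring)
  have h := hasDerivAt_bracket (M := fun x => dressedMatrix c l l' x t) (p := 1) (m := 1) (p' := 0)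
    (m' := 0) (Complex.I • l') (-(Complex.I • l)) 0 (fun i k => ?_) (fun x => hdet x t) hα hβ g f
  · refine h.congr_deriv ?_
    have h1 : g * -(Complex.I • l) = (-Complex.I) • (l * g) := by
      rw [neg_smul, mul_neg, mul_smul_comm, mul_comm]
    have h2 : f * (Complex.I • l') = Complex.I • (l' * f) := by
      rw [mul_smul_comm, mul_comm]
    rw [h1, h2, bracket_smul_left, bracket_smul_right]
    simp only [dressedBracket]
    ring
  · have h1 := ((((hα i).mul (hβ k)).const_mul Complex.I).div_const (l' i - l k)).const_sub
      (if i = k then (1 : ℂ) else 0)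
    refine h1.congr_deriv ?_
    have := sub_ne_zero.mpr (hne i k)
    simp only [Pi.one_apply, Pi.zero_apply]
    field_simp
    linear_combination (-(leftVec c l' x t i * rightVec l x t k * (l' i - l k))) * Complex.I_sq

theorem hasDerivAt_dressedBracket_t (hne : ∀ i k, l' i ≠ l k)
    (hdet : ∀ x t, (dressedMatrix c l l' x t).det ≠ 0) (g f : ι → ℂ) (x t : ℝ) :
    HasDerivAt (fun t => dressedBracket c l l' g f x t)
      (Complex.I * dressedBracket c l l' (l * (l * g)) f x t
        - Complex.I * dressedBracket c l l' g (l' * (l' * f)) x t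
        + dressedBracket c l l' g l' x t * dressedBracket c l l' 1 f x t
        + dressedBracket c l l' g 1 x t * dressedBracket c l l' l f x t) t := by
  have hα : ∀ i, HasDerivAt (fun t => leftVec c l' x t i)
      (-(Complex.I * l' i ^ 2) * leftVec c l' x t i) t := fun i =>
    (((hasDerivAt_phase_t (l' i) x t).cexp).const_mul (Complex.I * c i)).congr_deriv (by
      rw [leftVec]; ring)
  have hβ : ∀ k, HasDerivAt (fun t => rightVec l x t k)
      (Complex.I * l k ^ 2 * rightVec l x t k) t := fun k =>
    ((hasDerivAt_phase_t (l k) x t).neg.cexp).congr_deriv (by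
      simp only [rightVec, Pi.neg_apply]; ring)
  have h := hasDerivAt_bracket (M := fun t => dressedMatrix c l l' x t)
    (α := fun t => leftVec c l' x t) (β := fun t => rightVec l x t) (s := t)
    (p := -l') (m := 1) (p' := 1) (m' := l) (fun i => -(Complex.I * l' i ^ 2))
    (fun k => Complex.I * l k ^ 2) (-1) (fun i k => ?_) (fun t => hdet x t) hα hβ g f
  · refine h.congr_deriv ?_
    have h1 : (g * fun k => Complex.I * l k ^ 2) = Complex.I • (l * (l * g)) := by
      funext k
      simp only [Pi.mul_apply, Pi.smul_apply, smul_eq_mul]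
      ring
    have h2 : (f * fun i => -(Complex.I * l' i ^ 2)) = (-Complex.I) • (l' * (l' * f)) := by
      funext i
      simp only [Pi.mul_apply, Pi.smul_apply, smul_eq_mul]
      ring
    have h3 : -l' = (-1 : ℂ) • l' := by simp
    rw [h1, h2, h3, bracket_smul_left, bracket_smul_right, bracket_smul_right]
    simp only [dressedBracket]
    ring
  · have h1 := ((((hα i).mul (hβ k)).const_mul Complex.I).div_const (l' i - l k)).const_sub
      (if i = k then (1 : ℂ) else 0)
    refine h1.congr_deriv ?_
    have := sub_ne_zero.mpr (hne i k)
    simp only [Pi.one_apply, Pi.neg_apply]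
    field_simp
    linear_combination (leftVec c l' x t i * rightVec l x t k * (l' i ^ 2 - l k ^ 2)) *
      Complex.I_sq

/-- The dressed function `h = 1 - i ⟨(l + e)⁻¹, 1⟩`. -/
noncomputable def dressedFun (c l l' : ι → ℂ) (e : ℂ) (x t : ℝ) : ℂ :=
  1 - Complex.I * dressedBracket c l l' (fun k => (l k + e)⁻¹) 1 x t

/-- The dressed function solves `i h_t + h_xx - 2 i e h_x + 2 w_x h = 0`, where `w = ⟨1, 1⟩`. The
potential `w_x = i ⟨1, l'⟩ - i ⟨l, 1⟩ - w²` is written as the weighted bracket `i ⟨1, 1⟩`, to which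
it is equal by `bracket_mul_bracket`. -/
theorem exists_derivs_dressedFun (hne : ∀ i k, l' i ≠ l k)
    (hdet : ∀ x t, (dressedMatrix c l l' x t).det ≠ 0) (e : ℂ) (he : ∀ k, l k + e ≠ 0) :
    ∃ hx hxx ht : ℝ → ℝ → ℂ,
      (∀ x t, HasDerivAt (fun x => dressedFun c l l' e x t) (hx x t) x) ∧
      (∀ x t, HasDerivAt (fun x => hx x t) (hxx x t) x) ∧
      (∀ x t, HasDerivAt (fun t => dressedFun c l l' e x t) (ht x t) t) ∧
      ∀ x t, Complex.I * ht x t + hxx x t - 2 * Complex.I * e * hx x t +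
        2 * (Complex.I * weightedBracket (dressedMatrix c l l' x t) (leftVec c l' x t)
          (rightVec l x t) l l' 1 1) * dressedFun c l l' e x t = 0 := by
  set γ : ι → ℂ := fun k => (l k + e)⁻¹ with hγ
  set S : (ι → ℂ) → (ι → ℂ) → ℝ → ℝ → ℂ := fun g f x t => dressedBracket c l l' g f x t with hS
  have hlγ : l * γ = 1 + (-e) • γ := by
    funext k
    have := he k
    simp only [hγ, Pi.mul_apply, Pi.add_apply, Pi.one_apply, Pi.smul_apply, smul_eq_mul]
    field_simp
    ring
  have hllγ : l * (l * γ) = l + (-e) • (1 + (-e) • γ) := by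
    rw [hlγ, mul_add, mul_one, mul_smul_comm, hlγ]
  have hadd : ∀ g g' f x t, S (g + g') f x t = S g f x t + S g' f x t := fun g g' f x t =>
    bracket_add_left _ _ _ _ _ _
  have hsmul : ∀ (a : ℂ) g f x t, S (a • g) f x t = a * S g f x t := fun a g f x t =>
    bracket_smul_left _ _ _ _ _ _
  have hSx := hasDerivAt_dressedBracket_x (c := c) hne hdet
  have hHx : ∀ x t, HasDerivAt (fun x => S γ 1 x t) (-Complex.I * S 1 1 x t
      + Complex.I * e * S γ 1 x t + Complex.I * S γ l' x t - S γ 1 x t * S 1 1 x t) x := by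
    intro x t
    refine (hSx γ 1 x t).congr_deriv ?_
    change -Complex.I * S (l * γ) 1 x t + Complex.I * S γ (l' * 1) x t
      - S γ 1 x t * S 1 1 x t = _
    rw [hlγ, hadd, hsmul, mul_one]
    ring
  have hwx : ∀ x t, HasDerivAt (fun x => S 1 1 x t) (-Complex.I * S l 1 x t
      + Complex.I * S 1 l' x t - S 1 1 x t * S 1 1 x t) x := by
    intro x t
    have h := hSx 1 1 x t
    rw [mul_one, mul_one] at h
    exact h
  have hKx : ∀ x t, HasDerivAt (fun x => S γ l' x t) (-Complex.I * S 1 l' x t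
      + Complex.I * e * S γ l' x t + Complex.I * S γ (l' * l') x t
      - S γ 1 x t * S 1 l' x t) x := by
    intro x t
    refine (hSx γ l' x t).congr_deriv ?_
    change -Complex.I * S (l * γ) l' x t + Complex.I * S γ (l' * l') x t
      - S γ 1 x t * S 1 l' x t = _
    rw [hlγ, hadd, hsmul]
    ring
  have hHt : ∀ x t, HasDerivAt (fun t => S γ 1 x t) (Complex.I * (S l 1 x t - e * S 1 1 x t
      + e ^ 2 * S γ 1 x t) - Complex.I * S γ (l' * l') x t + S γ l' x t * S 1 1 x t
      + S γ 1 x t * S l 1 x t) t := by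
    intro x t
    refine (hasDerivAt_dressedBracket_t (c := c) hne hdet γ 1 x t).congr_deriv ?_
    change Complex.I * S (l * (l * γ)) 1 x t - Complex.I * S γ (l' * (l' * 1)) x t
      + S γ l' x t * S 1 1 x t + S γ 1 x t * S l 1 x t = _
    rw [hllγ, hadd, hsmul, hadd, hsmul, mul_one]
    ring
  refine ⟨_, _, _, fun x t => ((hHx x t).const_mul Complex.I).const_sub 1,
    fun x t => (((((hwx x t).const_mul (-Complex.I)).add
      ((hHx x t).const_mul (Complex.I * e))).add ((hKx x t).const_mul Complex.I)).sub
      ((hHx x t).mul (hwx x t))).const_mul Complex.I |>.neg,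
    fun x t => ((hHt x t).const_mul Complex.I).const_sub 1, fun x t => ?_⟩
  have hU : S 1 1 x t * S 1 1 x t = Complex.I * (S 1 l' x t - S l 1 x t
      - weightedBracket (dressedMatrix c l l' x t) (leftVec c l' x t) (rightVec l x t) l l'
        1 1) := by
    have h := bracket_mul_bracket (isDressed_dressedMatrix (c := c) hne x t) (hdet x t) 1 1
    rw [mul_one, mul_one] at h
    exact h
  have hh : dressedFun c l l' e x t = 1 - Complex.I * S γ 1 x t := rfl
  rw [hh]
  have hI := Complex.I_sq
  generalize weightedBracket (dressedMatrix c l l' x t) (leftVec c l' x t) (rightVec l x t)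
    l l' 1 1 = U at hU ⊢
  have hU' : Complex.I * U = -Complex.I * S l 1 x t + Complex.I * S 1 l' x t
      - S 1 1 x t * S 1 1 x t := by
    linear_combination hU
  rw [hU']
  generalize S 1 1 x t = w
  generalize S γ 1 x t = H
  generalize S γ l' x t = K
  generalize S l 1 x t = p
  generalize S 1 l' x t = r
  generalize S γ (l' * l') x t = L
  -- What remains is a polynomial identity in the six brackets, modulo `I ^ 2 = -1`.
  grind

end Evolution

/-! ### Quotients of tau functions as dressed functions -/

theorem det_add_vecMulVec_eq {M : Matrix ι ι ℂ} (hdet : M.det ≠ 0) (a b : ι → ℂ) :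
    (M + vecMulVec a b).det = M.det * (1 + b ⬝ᵥ (M⁻¹ *ᵥ a)) := by
  have h : replicateRow Unit b * M⁻¹ * replicateCol Unit a = of fun _ _ => b ⬝ᵥ (M⁻¹ *ᵥ a) := by
    ext i k
    rw [Matrix.mul_assoc, ← replicateCol_mulVec, replicateRow_mul_replicateCol_apply, of_apply]
  rw [vecMulVec_eq Unit, det_add_replicateCol_mul_replicateRow (isUnit_iff_ne_zero.mpr hdet), h]
  simp

/-- The exponentials `exp (2 Im l x - 2 Im l² t - d)` of the solitons with spectral parameters
`l`. -/
noncomputable def solitonExp (l : ι → ℂ) (d : ι → ℝ) (x t : ℝ) (k : ι) : ℝ :=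
  Real.exp (2 * (l k).im * x - 2 * (l k ^ 2).im * t - d k)

/-- The quotient of tau functions of the dark soliton component with background wave number `e`: in
the numerator the exponentials are multiplied by the phases `(l̄ + e) / (l + e)`. -/
noncomputable def tauRatio (l : ι → ℂ) (d : ι → ℝ) (e : ℝ) (x t : ℝ) : ℂ :=
  tau l (fun k => (conj (l k) + e) / (l k + e) * solitonExp l d x t k)
    / tau l (fun k => (solitonExp l d x t k : ℂ))

/-- The coefficients of the left vector for which the dressed matrix has the tau function as its
determinant. -/
noncomputable def leftCoeff (l : ι → ℂ) (d : ι → ℝ) (i : ι) : ℂ :=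
  (conj (l i) - l i) * Complex.exp (-(d i : ℂ))

theorem solitonExp_eq {ι : Type} (l : ι → ℂ) (d : ι → ℝ) (x t : ℝ) (k : ι) :
    (solitonExp l d x t k : ℂ) = Complex.exp (-(d k : ℂ)) *
      Complex.exp (phase (conj (l k)) x t) * rightVec l x t k := by
  rw [solitonExp, rightVec, ← Complex.exp_add, ← Complex.exp_add, Complex.ofReal_exp]
  congr 1
  have h1 := Complex.sub_conj (l k)
  have h2 := Complex.sub_conj (l k ^ 2)
  rw [map_pow] at h2
  simp only [phase]
  push_cast at h1 h2 ⊢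
  linear_combination (Complex.I * x) * h1 - (Complex.I * t) * h2
    + (2 * (l k).im * x - 2 * (l k ^ 2).im * t : ℂ) * Complex.I_sq

theorem solitonExp_pos {ι : Type} (l : ι → ℂ) (d : ι → ℝ) (x t : ℝ) (k : ι) :
    0 < solitonExp l d x t k :=
  Real.exp_pos _

theorem add_ofReal_ne_zero {ι : Type} {l : ι → ℂ} (hl : ∀ i k, conj (l i) ≠ l k) (e : ℝ) (k : ι) :
    l k + e ≠ 0 := by
  intro h
  refine hl k k ?_
  rw [eq_neg_of_add_eq_zero_left h, map_neg, Complex.conj_ofReal]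

theorem conj_add_ofReal_ne_zero {ι : Type} {l : ι → ℂ} (hl : ∀ i k, conj (l i) ≠ l k) (e : ℝ)
    (k : ι) :
    conj (l k) + e ≠ 0 := by
  have h := (map_ne_zero (starRingEnd ℂ)).mpr (add_ofReal_ne_zero hl e k)
  rwa [map_add, Complex.conj_ofReal] at h

section TauRatio

variable {l : ι → ℂ} (hl : ∀ i k, conj (l i) ≠ l k) (d : ι → ℝ)
include hl

theorem tau_eq_det_dressedMatrix (x t : ℝ) :
    tau l (fun k => (solitonExp l d x t k : ℂ)) =
      (dressedMatrix (leftCoeff l d) l (fun i => conj (l i)) x t).det := by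
  refine det_eq_of_gauge (rightVec l x t) (fun i => Complex.exp_ne_zero _) fun i k => ?_
  have := sub_ne_zero.mpr (hl i k)
  simp only [Matrix.add_apply, diagonal_mul, one_apply, cauchyMatrix, dressedMatrix, of_apply,
    solitonExp_eq, leftVec, leftCoeff]
  split_ifs with h
  · subst h
    field_simp
    simp only [Complex.I_sq]
    ring
  · field_simp
    simp only [Complex.I_sq]
    ring

theorem det_dressedMatrix_ne_zero (x t : ℝ) :
    (dressedMatrix (leftCoeff l d) l (fun i => conj (l i)) x t).det ≠ 0 := by
  rw [← tau_eq_det_dressedMatrix hl, tau_ofReal hl]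
  exact Complex.ofReal_ne_zero.mpr (realTau_pos hl (solitonExp_pos l d x t)).ne'

/-- The phases in the numerator amount to a perturbation of the dressed matrix of rank one, so the
quotient of tau functions is a dressed function. -/
theorem tauRatio_eq_dressedFun (e : ℝ) (x t : ℝ) :
    tauRatio l d e x t = dressedFun (leftCoeff l d) l (fun i => conj (l i)) e x t := by
  have hdet := det_dressedMatrix_ne_zero hl d x t
  set α := leftVec (leftCoeff l d) (fun i => conj (l i)) x t with hα
  have he := add_ofReal_ne_zero hl e
  have hnum : tau l (fun k => (conj (l k) + e) / (l k + e) * solitonExp l d x t k) =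
      (dressedMatrix (leftCoeff l d) l (fun i => conj (l i)) x t
        + vecMulVec ((-Complex.I) • α) ((fun k => (l k + e)⁻¹) * rightVec l x t)).det := by
    refine det_eq_of_gauge (fun k => (l k + e)⁻¹ * rightVec l x t k)
      (fun i => mul_ne_zero (inv_ne_zero (he i)) (Complex.exp_ne_zero _)) fun i k => ?_
    have h1 := sub_ne_zero.mpr (hl i k)
    have h2 := he i
    have h3 := he k
    simp only [Matrix.add_apply, diagonal_mul, one_apply, cauchyMatrix, dressedMatrix, of_apply,
      solitonExp_eq, vecMulVec_apply, hα, leftVec, leftCoeff, Pi.smul_apply, Pi.mul_apply,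
      smul_eq_mul]
    split_ifs with h
    · subst h
      field_simp
      simp only [Complex.I_sq]
      ring
    · field_simp
      simp only [Complex.I_sq]
      ring
  rw [tauRatio, hnum, tau_eq_det_dressedMatrix hl, det_add_vecMulVec_eq hdet,
    mul_div_cancel_left₀ _ hdet, dressedFun, dressedBracket, bracket, mulVec_smul, dotProduct_smul,
    one_mul, smul_eq_mul]
  ring

/-- The coefficients of the tau function are real, so conjugation inverts the phases in the
numerator; this is again a perturbation of rank one, now on the left. -/
theorem conj_tauRatio (e : ℝ) (x t : ℝ) :
    conj (tauRatio l d e x t) = 1 + Complex.I * dressedBracket (leftCoeff l d) l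
      (fun i => conj (l i)) 1 (fun k => (conj (l k) + e)⁻¹) x t := by
  have hdet := det_dressedMatrix_ne_zero hl d x t
  set α := leftVec (leftCoeff l d) (fun i => conj (l i)) x t with hα
  have he := add_ofReal_ne_zero hl e
  have he' := conj_add_ofReal_ne_zero hl e
  have hnum : tau l (fun k => (l k + e) / (conj (l k) + e) * solitonExp l d x t k) =
      (dressedMatrix (leftCoeff l d) l (fun i => conj (l i)) x t
        + vecMulVec (Complex.I • ((fun k => (conj (l k) + e)⁻¹) * α)) (rightVec l x t)).det := by
    refine det_eq_of_gauge (fun k => (l k + e) * rightVec l x t k)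
      (fun i => mul_ne_zero (he i) (Complex.exp_ne_zero _)) fun i k => ?_
    have h1 := sub_ne_zero.mpr (hl i k)
    have h2 := he' i
    have h3 := he' k
    simp only [Matrix.add_apply, diagonal_mul, one_apply, cauchyMatrix, dressedMatrix, of_apply,
      solitonExp_eq, vecMulVec_apply, hα, leftVec, leftCoeff, Pi.smul_apply, Pi.mul_apply,
      smul_eq_mul]
    split_ifs with h
    · subst h
      field_simp
      simp only [Complex.I_sq]
      ring
    · field_simp
      simp only [Complex.I_sq]
      ring
  rw [tauRatio, map_div₀, conj_tau hl, conj_tau hl]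
  simp only [map_mul, map_div₀, map_add, Complex.conj_conj, Complex.conj_ofReal]
  rw [hnum, tau_eq_det_dressedMatrix hl, det_add_vecMulVec_eq hdet,
    mul_div_cancel_left₀ _ hdet, dressedBracket, bracket, mulVec_smul, dotProduct_smul,
    one_mul, smul_eq_mul]

/-- The coupled equations for the quotients of tau functions: the linear equations of the dressed
functions, with the potential `w_x` expressed by the quotients themselves. -/
theorem exists_derivs_tauRatio {J : Type} [Fintype J] {e q : J → ℝ}
    (hq : ∀ k, 1 + ∑ j, (q j : ℂ) / ((l k + e j) * (conj (l k) + e j)) = 0) (j : J) :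
    ∃ hx hxx ht : ℝ → ℝ → ℂ,
      (∀ x t, HasDerivAt (fun x => tauRatio l d (e j) x t) (hx x t) x) ∧
      (∀ x t, HasDerivAt (fun x => hx x t) (hxx x t) x) ∧
      (∀ x t, HasDerivAt (fun t => tauRatio l d (e j) x t) (ht x t) t) ∧
      ∀ x t, Complex.I * ht x t + hxx x t - 2 * Complex.I * e j * hx x t +
        2 * (∑ k, (q k : ℂ) * ((‖tauRatio l d (e k) x t‖ : ℂ) ^ 2 - 1)) * tauRatio l d (e j) x t
          = 0 := by
  obtain ⟨hx, hxx, ht, h1, h2, h3, h4⟩ := exists_derivs_dressedFun (c := leftCoeff l d) hl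
    (det_dressedMatrix_ne_zero hl d) (e j) (add_ofReal_ne_zero hl (e j))
  simp only [← tauRatio_eq_dressedFun hl] at h1 h3 h4
  refine ⟨hx, hxx, ht, h1, h2, h3, fun x t => ?_⟩
  rw [← h4 x t, ← sum_mul_sub_one (e := fun j => (e j : ℂ)) (q := fun j => (q j : ℂ))
    (isDressed_dressedMatrix hl x t)
    (det_dressedMatrix_ne_zero hl d x t) (fun k j => add_ofReal_ne_zero hl (e j) k)
    (fun k j => conj_add_ofReal_ne_zero hl (e j) k) hq]
  have hsum : ∀ k, (‖tauRatio l d (e k) x t‖ : ℂ) ^ 2 =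
      dressedFun (leftCoeff l d) l (fun i => conj (l i)) (e k) x t *
        (1 + Complex.I * dressedBracket (leftCoeff l d) l
          (fun i => conj (l i)) 1 (fun i => (conj (l i) + e k)⁻¹) x t) := fun k => by
    rw [← Complex.mul_conj', conj_tauRatio hl, tauRatio_eq_dressedFun hl]
  simp only [hsum]
  rfl

end TauRatio

/-! ### Bounds, limits and smoothness of the quotients -/

section Asymptotics

theorem norm_phaseFactor {z : ℂ} {e : ℝ} (hz : z + e ≠ 0) : ‖(conj z + e) / (z + e)‖ = 1 := by
  have : conj z + e = conj (z + e) := by rw [map_add, Complex.conj_ofReal]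
  rw [norm_div, this, Complex.norm_conj, div_self (norm_ne_zero_iff.mpr hz)]

variable {l : ι → ℂ} (hl : ∀ i k, conj (l i) ≠ l k)
  (d : ι → ℝ) (e : ℝ)

include hl

omit [Fintype ι] [DecidableEq ι] in
theorem im_ne_zero (k : ι) : (l k).im ≠ 0 := fun h => hl k k (Complex.conj_eq_iff_im.mpr h)

theorem norm_tauRatio_lt_one [Nonempty ι] (x t : ℝ) : ‖tauRatio l d e x t‖ < 1 := by
  obtain ⟨k₀⟩ := ‹Nonempty ι›
  have hy := solitonExp_pos l d x t
  have he := add_ofReal_ne_zero hl e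
  have hpos := realTau_pos hl hy
  rw [tauRatio, norm_div, tau_ofReal hl, Complex.norm_real, Real.norm_of_nonneg hpos.le,
    div_lt_one hpos]
  refine norm_tau_phase_lt hl hy (fun k => norm_phaseFactor (he k)) (k₀ := k₀) ?_
  rw [ne_eq, div_eq_one_iff_eq (he k₀), add_left_inj]
  exact hl k₀ k₀

/-- Along a filter on which `x` or `-x` tends to `∞` the modulus of the quotient tends to `1`. -/
theorem tendsto_norm_tauRatio {ε : ℝ} (hε : ε ≠ 0) {f : Filter ℝ}
    (hf : Tendsto (fun x => ε * x) f atTop) (t : ℝ) :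
    Tendsto (fun x => ‖tauRatio l d e x t‖) f (nhds 1) := by
  have hlim : ∀ k, 0 < ε * (l k).im → Tendsto (fun x => 2 * (l k).im * x) f atTop := by
    intro k hk
    have h := hf.const_mul_atTop (show 0 < 2 * (ε * (l k).im) / ε ^ 2 by positivity)
    refine h.congr fun x => ?_
    field_simp
  have hlim' : ∀ k, ε * (l k).im < 0 → Tendsto (fun x => 2 * (l k).im * x) f atBot := by
    intro k hk
    have h := hf.const_mul_atTop_of_neg (show 2 * (ε * (l k).im) / ε ^ 2 < 0 from
      div_neg_of_neg_of_pos (by linarith) (by positivity))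
    refine h.congr fun x => ?_
    field_simp
  have harg : ∀ k, (fun x => solitonExp l d x t k) = fun x =>
      Real.exp (2 * (l k).im * x + (-(2 * (l k ^ 2).im * t) - d k)) := fun k => by
    funext x
    rw [solitonExp]
    ring_nf
  have h := tendsto_norm_tau_phase_div hl (l := f) (y := fun x => solitonExp l d x t)
    (fun x => solitonExp_pos l d x t) {z | 0 < ε * z.im} (fun k hk => ?_) (fun k hk => ?_)
    (ρ := fun z => (conj z + e) / (z + e)) fun k => norm_phaseFactor (add_ofReal_ne_zero hl e k)
  · refine h.congr fun x => ?_
    rw [tauRatio, tau_ofReal hl]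
  · rw [harg]
    exact Real.tendsto_exp_atTop.comp (tendsto_atTop_add_const_right _ _ (hlim k hk))
  · have hk' : ε * (l k).im < 0 :=
      lt_of_le_of_ne (not_lt.mp hk) (mul_ne_zero hε (im_ne_zero hl k))
    rw [harg]
    exact Real.tendsto_exp_atBot.comp (tendsto_atBot_add_const_right _ _ (hlim' k hk'))

theorem contDiff_tauRatio : ContDiff ℝ ∞ fun p : ℝ × ℝ => tauRatio l d e p.1 p.2 := by
  have hexp : ∀ k, ContDiff ℝ ∞ fun p : ℝ × ℝ => (solitonExp l d p.1 p.2 k : ℂ) := by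
    intro k
    have h : ContDiff ℝ ∞ fun p : ℝ × ℝ => solitonExp l d p.1 p.2 k := by
      unfold solitonExp
      fun_prop
    exact Complex.ofRealCLM.contDiff.comp h
  unfold tauRatio
  simp only [div_eq_mul_inv]
  refine ContDiff.mul ?_ (ContDiff.inv ?_ fun p => ?_)
  · simp only [tau_eq_sum hl]
    exact ContDiff.sum fun s _ => contDiff_const.mul (contDiff_prod fun k _ =>
      contDiff_const.mul (hexp k))
  · simp only [tau_eq_sum hl]
    exact ContDiff.sum fun s _ => contDiff_const.mul (contDiff_prod fun k _ => hexp k)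
  · rw [tau_ofReal hl]
    exact Complex.ofReal_ne_zero.mpr (realTau_pos hl (solitonExp_pos l d p.1 p.2)).ne'

end Asymptotics

/-! ### The rational function -/

section RatFun

open DarkNLS Polynomial

variable {m : ℕ} {a b : Fin m → ℂ}

theorem ratFun_eq_div (w : ℂ) : ratFun a b w = (∏ i, (w - a i)) / ∏ i, (w - b i) := by
  rw [ratFun, Finset.prod_div_distrib]

theorem deriv_ratFun (hab : ∀ i k, a i ≠ b k) (i : Fin m) :
    deriv (ratFun a b) (a i) =
      (∏ k ∈ Finset.univ.erase i, (a i - a k)) / ∏ k, (a i - b k) := by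
  have hden : ∏ k, (a i - b k) ≠ 0 :=
    Finset.prod_ne_zero_iff.mpr fun k _ => sub_ne_zero.mpr (hab i k)
  have hd : DifferentiableAt ℂ (fun w => (∏ k ∈ Finset.univ.erase i, (w - a k)) / ∏ k, (w - b k))
      (a i) := by
    refine DifferentiableAt.fun_div ?_ ?_ hden
    · exact DifferentiableAt.fun_finsetProd fun k _ => differentiableAt_id.sub_const _
    · exact DifferentiableAt.fun_finsetProd fun k _ => differentiableAt_id.sub_const _
  have h := ((hasDerivAt_id (a i)).sub_const (a i)).mul hd.hasDerivAt
  have heq : ratFun a b = fun w => (w - a i) *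
      ((∏ k ∈ Finset.univ.erase i, (w - a k)) / ∏ k, (w - b k)) := by
    funext w
    rw [ratFun_eq_div, ← Finset.mul_prod_erase _ _ (Finset.mem_univ i), mul_div_assoc]
  rw [heq]
  refine h.deriv.trans ?_
  simp

theorem deriv_ratFun_ne_zero (ha : Function.Injective a) (hab : ∀ i k, a i ≠ b k) (i : Fin m) :
    deriv (ratFun a b) (a i) ≠ 0 := by
  rw [deriv_ratFun hab]
  refine div_ne_zero (Finset.prod_ne_zero_iff.mpr fun k hk => ?_)
    (Finset.prod_ne_zero_iff.mpr fun k _ => sub_ne_zero.mpr (hab i k))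
  exact sub_ne_zero.mpr fun h => (Finset.mem_erase.mp hk).1 (ha h).symm

/-- The partial fraction decomposition of `1 / f`, whose residues are `1 / f'(aᵢ)`. It holds at the
poles of `f` too, where `ratFun` and its inverse are `0`. -/
theorem inv_ratFun (ha : Function.Injective a) (hab : ∀ i k, a i ≠ b k) {w : ℂ}
    (hw : ∀ i, w ≠ a i) :
    (ratFun a b w)⁻¹ = 1 + ∑ i, (deriv (ratFun a b) (a i))⁻¹ * (w - a i)⁻¹ := by
  set P : ℂ[X] := ∏ i, (X - C (b i)) - ∏ i, (X - C (a i)) with hP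
  have hdeg : ∀ c : Fin m → ℂ, (∏ i, (X - C (c i))).degree = (m : WithBot ℕ) := fun c => by
    rw [degree_prod]
    simp
  have hmonic : ∀ c : Fin m → ℂ, (∏ i, (X - C (c i))).Monic := fun c =>
    monic_prod_of_monic _ _ fun i _ => monic_X_sub_C _
  have hlt : P.degree < (Finset.univ : Finset (Fin m)).card := by
    refine lt_of_lt_of_le (degree_sub_lt_left ?_ (hmonic b).ne_zero ?_) ?_
    · rw [hdeg, hdeg]
    · rw [(hmonic b).leadingCoeff, (hmonic a).leadingCoeff]
    · rw [hdeg]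
      simp
  have hint := Lagrange.eq_interpolate (s := Finset.univ) (v := a) (fun i _ k _ h => ha h) hlt
  have heval := congrArg (eval w) hint
  rw [Lagrange.eval_interpolate_not_at_node _ fun i _ => hw i] at heval
  have hA : ∏ i, (w - a i) ≠ 0 := Finset.prod_ne_zero_iff.mpr fun i _ => sub_ne_zero.mpr (hw i)
  have hPw : eval w P = ∏ i, (w - b i) - ∏ i, (w - a i) := by
    simp [hP, eval_prod]
  have hnode : eval w (Lagrange.nodal Finset.univ a) = ∏ i, (w - a i) := Lagrange.eval_nodal
  have hr : ∀ i, Lagrange.nodalWeight Finset.univ a i * (w - a i)⁻¹ * eval (a i) P =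
      (deriv (ratFun a b) (a i))⁻¹ * (w - a i)⁻¹ := by
    intro i
    have h0 : ∏ k, (a i - a k) = 0 := Finset.prod_eq_zero (Finset.mem_univ i) (sub_self _)
    have h1 : eval (a i) P = ∏ k, (a i - b k) := by
      simp [hP, eval_prod, h0]
    rw [deriv_ratFun hab, h1, Lagrange.nodalWeight, Finset.prod_inv_distrib, inv_div]
    ring
  simp only [hr] at heval
  rw [hPw, hnode] at heval
  rw [ratFun_eq_div, inv_div, div_eq_iff hA]
  linear_combination heval

theorem ratFun_conj (ha : ∀ i, (a i).im = 0) (hb : ConjInvariant b) (w : ℂ) :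
    ratFun a b (conj w) = conj (ratFun a b w) := by
  obtain ⟨σ, hσ⟩ := hb
  rw [ratFun_eq_div, ratFun_eq_div, map_div₀, map_prod, map_prod]
  simp only [map_sub, hσ, Complex.conj_eq_iff_im.mpr (ha _)]
  rw [Equiv.prod_comp σ fun i => conj w - b i]

theorem conj_deriv_ratFun (ha : ∀ i, (a i).im = 0) (hb : ConjInvariant b) (w : ℂ) :
    deriv (ratFun a b) (conj w) = conj (deriv (ratFun a b) w) := by
  have h : conj ∘ ratFun a b ∘ conj = ratFun a b := by
    funext w
    simp [ratFun_conj ha hb]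
  conv_rhs => rw [← h, deriv_conj_conj, Function.comp_apply, Function.comp_apply,
    Complex.conj_conj]

theorem conj_deriv2_ratFun (ha : ∀ i, (a i).im = 0) (hb : ConjInvariant b) (w : ℂ) :
    iteratedDeriv 2 (ratFun a b) (conj w) = conj (iteratedDeriv 2 (ratFun a b) w) := by
  have h2 : iteratedDeriv 2 (ratFun a b) = deriv (deriv (ratFun a b)) := by
    rw [iteratedDeriv_succ, iteratedDeriv_one]
  have h : conj ∘ deriv (ratFun a b) ∘ conj = deriv (ratFun a b) := by
    funext w
    simp [conj_deriv_ratFun ha hb]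
  rw [h2]
  conv_rhs => rw [← h, deriv_conj_conj, Function.comp_apply, Function.comp_apply,
    Complex.conj_conj]

/-- Two distinct points with the same value of `f` give a linear relation between the residues of
`1 / f`. For complex conjugate points its weights are positive. -/
theorem sum_residues_eq_zero (ha : Function.Injective a) (hab : ∀ i k, a i ≠ b k) {u v : ℂ}
    (hu : ∀ i, u ≠ a i) (hv : ∀ i, v ≠ a i) (huv : u ≠ v) (hf : ratFun a b u = ratFun a b v) :
    ∑ i, (deriv (ratFun a b) (a i))⁻¹ / ((u - a i) * (v - a i)) = 0 := by
  have h : (ratFun a b u)⁻¹ - (ratFun a b v)⁻¹ = 0 := by rw [hf, sub_self]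
  rw [inv_ratFun ha hab hu, inv_ratFun ha hab hv, add_sub_add_left_eq_sub,
    ← Finset.sum_sub_distrib] at h
  have h2 : ∀ i, (deriv (ratFun a b) (a i))⁻¹ * (u - a i)⁻¹ -
      (deriv (ratFun a b) (a i))⁻¹ * (v - a i)⁻¹ =
      (v - u) * ((deriv (ratFun a b) (a i))⁻¹ / ((u - a i) * (v - a i))) := by
    intro i
    have h3 := sub_ne_zero.mpr (hu i)
    have h4 := sub_ne_zero.mpr (hv i)
    have h5 := deriv_ratFun_ne_zero ha hab i
    field_simp
    ring
  simp only [h2] at h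
  rw [← Finset.mul_sum] at h
  exact (mul_eq_zero.mp h).resolve_left (sub_ne_zero.mpr huv.symm)

end RatFun

/-! ### The spectral parameter -/

section Spectral

open DarkNLS

/-- The spectral parameter of the point `w`: the Möbius coordinate
`1 / (f'(p) (p - w)) + f''(p) / (2 f'(p)²)`, which has a pole at `p`. In terms of it `V` and `W`
become differences of first and second powers. -/
noncomputable def spectral (f : ℂ → ℂ) (p w : ℂ) : ℂ :=
  1 / (deriv f p * (p - w)) + 1 / 2 * (iteratedDeriv 2 f p / deriv f p ^ 2)

variable {f : ℂ → ℂ} {p : ℂ}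

theorem conj_spectral (hp : conj p = p) (hf1 : conj (deriv f p) = deriv f p)
    (hf2 : conj (iteratedDeriv 2 f p) = iteratedDeriv 2 f p) (w : ℂ) :
    conj (spectral f p w) = spectral f p (conj w) := by
  simp [spectral, hp, hf1, hf2, map_div₀, Complex.conj_ofNat]

theorem spectral_sub_spectral (hf : deriv f p ≠ 0) {w w' : ℂ} (hw : p ≠ w) (hw' : p ≠ w') :
    spectral f p w - spectral f p w' = (w - w') / (deriv f p * (p - w) * (p - w')) := by
  have h1 := sub_ne_zero.mpr hw
  have h2 := sub_ne_zero.mpr hw'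
  rw [spectral, spectral, add_sub_add_right_eq_sub]
  field_simp
  ring

theorem V_eq (f : ℂ → ℂ) (p u v : ℂ) : V f p u v = spectral f p v - spectral f p u := by
  rw [V, spectral, spectral, add_sub_add_right_eq_sub, mul_sub, one_div_mul_one_div,
    one_div_mul_one_div]

theorem W_eq (f : ℂ → ℂ) (p u v : ℂ) :
    W f p u v = spectral f p u ^ 2 - spectral f p v ^ 2 := by
  rw [W, V, spectral, spectral]
  simp only [div_eq_mul_inv, mul_inv, ← inv_pow]
  ring

theorem spectral_add_K1 (hf : deriv f p ≠ 0) {w q : ℂ} (hw : p ≠ w) (hq : p ≠ q) :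
    spectral f p w + K1 f p q = (q - w) / (deriv f p * (q - p) * (p - w)) := by
  have h1 := sub_ne_zero.mpr hw
  have h2 := sub_ne_zero.mpr hq.symm
  rw [spectral, K1]
  field_simp
  ring

theorem exp_r (hf : deriv f p ≠ 0) {u v q : ℂ} (hu : p ≠ u) (hv : p ≠ v) (hq : p ≠ q)
    (hqu : q ≠ u) (hqv : q ≠ v) :
    Complex.exp (r p q u v) =
      (spectral f p v + K1 f p q) / (spectral f p u + K1 f p q) := by
  have h1 := sub_ne_zero.mpr hu
  have h2 := sub_ne_zero.mpr hv
  have h3 := sub_ne_zero.mpr hq.symm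
  have h4 := sub_ne_zero.mpr hqu
  have h5 := sub_ne_zero.mpr hqv
  rw [r, Complex.exp_log (mul_ne_zero (div_ne_zero h5 h4) (div_ne_zero h1 h2)),
    spectral_add_K1 hf hu hq, spectral_add_K1 hf hv hq]
  field_simp

theorem exp_Z (hp : conj p = p) (hf1 : conj (deriv f p) = deriv f p)
    (hf2 : conj (iteratedDeriv 2 f p) = iteratedDeriv 2 f p) {N : ℕ} {u : Fin N → ℂ}
    (d : Fin N → ℝ) (x t : ℝ) (k : Fin N) :
    Complex.exp (Z f p (u k) (conj (u k)) x t - d k) =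
      solitonExp (fun k => spectral f p (u k)) d x t k := by
  rw [solitonExp, Complex.ofReal_exp, Z, V_eq, W_eq, ← conj_spectral hp hf1 hf2]
  congr 1
  have h1 := Complex.sub_conj (spectral f p (u k))
  have h2 := Complex.sub_conj (spectral f p (u k) ^ 2)
  rw [map_pow] at h2
  push_cast at h1 h2 ⊢
  linear_combination (-(Complex.I * x)) * h1 + (Complex.I * t) * h2
    - (2 * (spectral f p (u k)).im * x - 2 * (spectral f p (u k) ^ 2).im * t : ℂ) * Complex.I_sq

/-- The determinant of `T` is the tau function of the spectral parameters. -/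
theorem det_T_eq_tau (hp : conj p = p) (hf : deriv f p ≠ 0)
    (hf1 : conj (deriv f p) = deriv f p)
    (hf2 : conj (iteratedDeriv 2 f p) = iteratedDeriv 2 f p) {N : ℕ} {u v z : Fin N → ℂ}
    (huv : ∀ k, conj (u k) = v k) (hne : ∀ i k, v i ≠ u k) (hu : ∀ k, p ≠ u k)
    (hv : ∀ k, p ≠ v k) :
    (T u v z).det = tau (fun k => spectral f p (u k)) fun k => Complex.exp (z k) := by
  refine det_eq_of_gauge (fun k => Complex.exp (-(1 / 2 * z k)) * (p - u k))
    (fun k => mul_ne_zero (Complex.exp_ne_zero _) (sub_ne_zero.mpr (hu k))) fun i k => ?_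
  have h1 := sub_ne_zero.mpr (hu i)
  have h2 := sub_ne_zero.mpr (hu k)
  have h3 := sub_ne_zero.mpr (hv i)
  have h4 := sub_ne_zero.mpr (hne i k)
  have h5 : Complex.exp (z i) = Complex.exp (1 / 2 * z i) ^ 2 := by
    rw [← Complex.exp_nat_mul]
    congr 1
    push_cast
    ring
  have h6 : Complex.exp (1 / 2 * (z i + z k)) =
      Complex.exp (1 / 2 * z i) * Complex.exp (1 / 2 * z k) := by
    rw [← Complex.exp_add, mul_add]
  simp only [Matrix.add_apply, diagonal_mul, one_apply, cauchyMatrix, T, of_apply,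
    conj_spectral hp hf1 hf2, huv, spectral_sub_spectral hf (hv i) (hu i),
    spectral_sub_spectral hf (hv i) (hu k), h5, h6, Complex.exp_neg]
  have h7 := Complex.exp_ne_zero (1 / 2 * z i)
  have h8 := Complex.exp_ne_zero (1 / 2 * z k)
  split_ifs with h
  · subst h
    field_simp
  · field_simp
    ring

end Spectral

/-! ### The dark soliton formula -/

section Assembly

open DarkNLS

variable {n N : ℕ} {a b : Fin (n + 1) → ℂ} {u v : Fin N → ℂ}

/-- The spectral parameters of the points `u`, with respect to the last zero of the rational
function. -/
noncomputable def spec (a b : Fin (n + 1) → ℂ) (u : Fin N → ℂ) (k : Fin N) : ℂ :=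
  spectral (ratFun a b) (a (Fin.last n)) (u k)

theorem ne_of_im {p w : ℂ} (hp : p.im = 0) (hw : conj w ≠ w) : p ≠ w := by
  rintro rfl
  exact hw (Complex.conj_eq_iff_im.mpr hp)

theorem conj_deriv_at_zero (ha_real : ∀ i, (a i).im = 0) (hb : ConjInvariant b)
    (i : Fin (n + 1)) : conj (deriv (ratFun a b) (a i)) = deriv (ratFun a b) (a i) := by
  rw [← conj_deriv_ratFun ha_real hb, Complex.conj_eq_iff_im.mpr (ha_real i)]

theorem conj_deriv2_at_zero (ha_real : ∀ i, (a i).im = 0) (hb : ConjInvariant b)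
    (i : Fin (n + 1)) :
    conj (iteratedDeriv 2 (ratFun a b) (a i)) = iteratedDeriv 2 (ratFun a b) (a i) := by
  rw [← conj_deriv2_ratFun ha_real hb, Complex.conj_eq_iff_im.mpr (ha_real i)]

theorem E_eq_re (ha_real : ∀ i, (a i).im = 0) (hb : ConjInvariant b) (j : Fin n) :
    E a b j = ((E a b j).re : ℂ) := by
  rw [eq_comm, ← Complex.conj_eq_iff_re]
  simp [E, K1, conj_deriv_at_zero ha_real hb, conj_deriv2_at_zero ha_real hb,
    Complex.conj_eq_iff_im.mpr (ha_real _), map_div₀, Complex.conj_ofNat]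

/-- The number `q₂` at the last zero and the `j`-th one. -/
noncomputable def weight (a b : Fin (n + 1) → ℂ) (j : Fin n) : ℝ :=
  (q2 (ratFun a b) (a (Fin.last n)) (a j.castSucc)).re

theorem q2_eq_weight (ha_real : ∀ i, (a i).im = 0) (hb : ConjInvariant b) (j : Fin n) :
    q2 (ratFun a b) (a (Fin.last n)) (a j.castSucc) = weight a b j := by
  rw [weight, eq_comm, ← Complex.conj_eq_iff_re]
  simp [q2, conj_deriv_at_zero ha_real hb, Complex.conj_eq_iff_im.mpr (ha_real _)]

theorem deriv_mul_deriv (ha_real : ∀ i, (a i).im = 0) (hb : ConjInvariant b) (j : Fin n) :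
    ((deriv (ratFun a b) (a (Fin.last n)) * deriv (ratFun a b) (a j.castSucc)).re : ℂ) =
      deriv (ratFun a b) (a (Fin.last n)) * deriv (ratFun a b) (a j.castSucc) := by
  rw [← Complex.conj_eq_iff_re, map_mul, conj_deriv_at_zero ha_real hb,
    conj_deriv_at_zero ha_real hb]

/-- `q₂` is the square of the amplitude up to the sign `s`. -/
theorem darkSign_mul_amp_sq (ha_inj : Function.Injective a) (hab : ∀ i k, a i ≠ b k)
    (ha_real : ∀ i, (a i).im = 0) (hb : ConjInvariant b) (j : Fin n) :
    (darkSign a b j = 1 ∨ darkSign a b j = -1) ∧ 0 < amp a b j ∧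
      darkSign a b j * amp a b j ^ 2 = weight a b j := by
  set D : ℝ := (deriv (ratFun a b) (a (Fin.last n)) * deriv (ratFun a b) (a j.castSucc)).re
    with hD
  set R : ℝ := (a (Fin.last n)).re - (a j.castSucc).re with hR
  have hDc := deriv_mul_deriv ha_real hb j
  rw [← hD] at hDc
  have hRc : (R : ℂ) = a (Fin.last n) - a j.castSucc := by
    rw [hR, Complex.ofReal_sub, Complex.conj_eq_iff_re.mp (Complex.conj_eq_iff_im.mpr (ha_real _)),
      Complex.conj_eq_iff_re.mp (Complex.conj_eq_iff_im.mpr (ha_real _))]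
  have hD0 : D ≠ 0 := by
    rw [← Complex.ofReal_ne_zero, hDc]
    exact mul_ne_zero (deriv_ratFun_ne_zero ha_inj hab _) (deriv_ratFun_ne_zero ha_inj hab _)
  have hR0 : R ≠ 0 := by
    rw [← Complex.ofReal_ne_zero, hRc, sub_ne_zero]
    exact fun h => j.castSucc_ne_last (ha_inj h).symm
  have hw : weight a b j = (D * R ^ 2)⁻¹ := by
    rw [← Complex.ofReal_inj, ← q2_eq_weight ha_real hb, q2, ← hDc, ← hRc]
    push_cast
    rw [one_div]
  have hamp : amp a b j ^ 2 = |D|⁻¹ * (R ^ 2)⁻¹ := by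
    rw [amp, Real.sq_sqrt (norm_nonneg _), q2_eq_weight ha_real hb, Complex.norm_real,
      Real.norm_eq_abs, hw, abs_inv, abs_mul, abs_of_nonneg (sq_nonneg R), mul_inv]
  have hpos : 0 < amp a b j := by
    have h1 : 0 < amp a b j ^ 2 := by
      rw [hamp]
      positivity
    exact lt_of_le_of_ne (Real.sqrt_nonneg _) fun h => by simp [← h] at h1
  refine ⟨?_, hpos, ?_⟩
  · rcases lt_or_gt_of_ne hD0 with h | h
    · exact Or.inr (Real.sign_of_neg h)
    · exact Or.inl (Real.sign_of_pos h)
  · rw [hamp, hw, darkSign, ← hD]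
    rcases lt_or_gt_of_ne hD0 with h | h
    · rw [Real.sign_of_neg h, abs_of_neg h]
      field_simp
    · rw [Real.sign_of_pos h, abs_of_pos h]
      field_simp

variable (ha_inj : Function.Injective a) (hab : ∀ i k, a i ≠ b k)
  (ha_real : ∀ i, (a i).im = 0) (hb : ConjInvariant b)
  (huv : ∀ k, conj (u k) = v k) (hne : ∀ i k, v i ≠ u k)
include ha_inj hab ha_real hb huv hne

omit ha_inj hab hb in
theorem zero_ne_points (i : Fin (n + 1)) (k : Fin N) : a i ≠ u k ∧ a i ≠ v k := by
  have h : conj (u k) ≠ u k := by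
    rw [huv]
    exact hne k k
  refine ⟨ne_of_im (ha_real i) h, ne_of_im (ha_real i) ?_⟩
  rw [← huv, Complex.conj_conj]
  exact h.symm

omit ha_inj hab hne in
theorem conj_spec (k : Fin N) :
    conj (spec a b u k) = spectral (ratFun a b) (a (Fin.last n)) (v k) := by
  rw [spec, conj_spectral (Complex.conj_eq_iff_im.mpr (ha_real _))
    (conj_deriv_at_zero ha_real hb _) (conj_deriv2_at_zero ha_real hb _), huv]

theorem conj_spec_ne (i k : Fin N) : conj (spec a b u i) ≠ spec a b u k := by
  have hz := zero_ne_points ha_real huv hne (Fin.last n)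
  have hd := deriv_ratFun_ne_zero ha_inj hab (Fin.last n)
  rw [conj_spec ha_real hb huv, spec, ← sub_ne_zero,
    spectral_sub_spectral hd (hz i).2 (hz k).1]
  exact div_ne_zero (sub_ne_zero.mpr (hne i k)) (mul_ne_zero (mul_ne_zero hd
    (sub_ne_zero.mpr (hz i).2)) (sub_ne_zero.mpr (hz k).1))

/-- The equation `f u = f v` in terms of the spectral parameter. -/
theorem spec_condition (hf : ∀ k, ratFun a b (u k) = ratFun a b (v k)) (k : Fin N) :
    1 + ∑ j, (weight a b j : ℂ) /
      ((spec a b u k + (E a b j).re) * (conj (spec a b u k) + (E a b j).re)) = 0 := by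
  have hz := fun i => zero_ne_points ha_real huv hne i k
  have h := sum_residues_eq_zero ha_inj hab (fun i => (hz i).1.symm) (fun i => (hz i).2.symm)
    (hne k k).symm (hf k)
  rw [Fin.sum_univ_castSucc] at h
  set p := a (Fin.last n) with hp
  have hd := deriv_ratFun_ne_zero ha_inj hab
  have h0 := sub_ne_zero.mpr (hz (Fin.last n)).1
  have h0' := sub_ne_zero.mpr (hz (Fin.last n)).2
  rw [← hp] at h0 h0'
  have hterm : ∀ j : Fin n, (weight a b j : ℂ) /
      ((spec a b u k + (E a b j).re) * (conj (spec a b u k) + (E a b j).re)) =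
      (deriv (ratFun a b) p * ((u k - p) * (v k - p))) *
      ((deriv (ratFun a b) (a j.castSucc))⁻¹ / ((u k - a j.castSucc) * (v k - a j.castSucc))) := by
    intro j
    have hpj : p ≠ a j.castSucc := fun h => j.castSucc_ne_last (ha_inj h).symm
    have h1 := sub_ne_zero.mpr (hz j.castSucc).1.symm
    have h2 := sub_ne_zero.mpr (hz j.castSucc).2.symm
    have h1' := sub_ne_zero.mpr (hz j.castSucc).1
    have h2' := sub_ne_zero.mpr (hz j.castSucc).2
    have h3 := sub_ne_zero.mpr hpj
    have h3' := sub_ne_zero.mpr hpj.symm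
    have h4 := hd j.castSucc
    have h5 := hd (Fin.last n)
    rw [← hp] at h5
    rw [← E_eq_re ha_real hb, conj_spec ha_real hb huv, ← q2_eq_weight ha_real hb,
      spec, E, spectral_add_K1 h5 (hz (Fin.last n)).1 hpj,
      spectral_add_K1 h5 (hz (Fin.last n)).2 hpj, q2, ← hp]
    field_simp
    ring
  simp only [hterm]
  rw [← Finset.mul_sum, eq_neg_of_add_eq_zero_left h]
  have h5 := hd (Fin.last n)
  rw [← hp] at h5
  have h6 := sub_ne_zero.mpr (hz (Fin.last n)).1.symm
  have h7 := sub_ne_zero.mpr (hz (Fin.last n)).2.symm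
  rw [← hp] at h6 h7
  field_simp
  ring

theorem det_T_zero (d : Fin N → ℝ) (j : Fin n) (x t : ℝ) :
    (T u v (zArg (ratFun a b) (a (Fin.last n)) (a j.castSucc) u v d 0 x t)).det =
      tau (spec a b u) fun k => (solitonExp (spec a b u) d x t k : ℂ) := by
  have hz := zero_ne_points ha_real huv hne (Fin.last n)
  have hp := Complex.conj_eq_iff_im.mpr (ha_real (Fin.last n))
  have hf1 := conj_deriv_at_zero ha_real hb (Fin.last n)
  have hf2 := conj_deriv2_at_zero ha_real hb (Fin.last n)
  rw [det_T_eq_tau hp (deriv_ratFun_ne_zero ha_inj hab _) hf1 hf2 huv hne (fun k => (hz k).1)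
    fun k => (hz k).2]
  congr 1
  funext k
  rw [zArg, zero_mul, add_zero, ← huv, exp_Z hp hf1 hf2]
  rfl

theorem det_T_one (d : Fin N → ℝ) (j : Fin n) (x t : ℝ) :
    (T u v (zArg (ratFun a b) (a (Fin.last n)) (a j.castSucc) u v d 1 x t)).det =
      tau (spec a b u) fun k => (conj (spec a b u k) + (E a b j).re)
        / (spec a b u k + (E a b j).re) * solitonExp (spec a b u) d x t k := by
  have hz := fun i => zero_ne_points ha_real huv hne i
  have hp := Complex.conj_eq_iff_im.mpr (ha_real (Fin.last n))
  have hf1 := conj_deriv_at_zero ha_real hb (Fin.last n)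
  have hf2 := conj_deriv2_at_zero ha_real hb (Fin.last n)
  have hd := deriv_ratFun_ne_zero ha_inj hab (Fin.last n)
  have hpj : a (Fin.last n) ≠ a j.castSucc := fun h => j.castSucc_ne_last (ha_inj h).symm
  rw [det_T_eq_tau hp hd hf1 hf2 huv hne (fun k => (hz _ k).1) fun k => (hz _ k).2]
  congr 1
  funext k
  rw [zArg, one_mul, add_comm, Complex.exp_add, exp_r hd (hz _ k).1 (hz _ k).2 hpj (hz _ k).1
    (hz _ k).2, conj_spec ha_real hb huv, ← E_eq_re ha_real hb, ← huv,
    exp_Z hp hf1 hf2]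
  rfl

/-- A component is its plane wave background times a quotient of tau functions. -/
theorem darkPsi_eq (d : Fin N → ℝ) (θ : ℝ) (j : Fin n) (x t : ℝ) :
    darkPsi a b u v d θ j x t = amp a b j * Complex.exp (Complex.I * θ)
      * tauRatio (spec a b u) d (E a b j).re x t
      * Complex.exp (Complex.I * (-(E a b j).re * x
          + (-(E a b j).re ^ 2 + 2 * ∑ k, (weight a b k : ℂ)) * t)) := by
  rw [darkPsi, det_T_zero ha_inj hab ha_real hb huv hne,
    det_T_one ha_inj hab ha_real hb huv hne, ← tauRatio, ← E_eq_re ha_real hb, F]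
  simp only [q2_eq_weight ha_real hb]
  rfl

theorem norm_darkPsi (d : Fin N → ℝ) (θ : ℝ) (j : Fin n) (x t : ℝ) :
    ‖darkPsi a b u v d θ j x t‖ =
      amp a b j * ‖tauRatio (spec a b u) d (E a b j).re x t‖ := by
  have h : Complex.I * (-(E a b j).re * x + (-(E a b j).re ^ 2 + 2 * ∑ k, (weight a b k : ℂ)) * t)
      = ((-(E a b j).re * x + (-(E a b j).re ^ 2 + 2 * ∑ k, weight a b k) * t : ℝ) : ℂ)
        * Complex.I := by
    push_cast
    ring
  have hA : ‖amp a b j‖ = amp a b j := Real.norm_of_nonneg (Real.sqrt_nonneg _)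
  rw [darkPsi_eq ha_inj hab ha_real hb huv hne, h, norm_mul, norm_mul, norm_mul,
    Complex.norm_exp_ofReal_mul_I, mul_comm Complex.I, Complex.norm_exp_ofReal_mul_I, mul_one,
    mul_one, Complex.norm_real, hA]

theorem solvesNLS_darkPsi (hf : ∀ k, ratFun a b (u k) = ratFun a b (v k)) (d : Fin N → ℝ)
    (θ : ℝ) : SolvesNLS (darkSign a b) (darkPsi a b u v d θ) := by
  intro j x t
  obtain ⟨hx, hxx, ht, h1, h2, h3, h4⟩ := exists_derivs_tauRatio
    (conj_spec_ne ha_inj hab ha_real hb huv hne) d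
    (spec_condition ha_inj hab ha_real hb huv hne hf) j
  set e : ℝ := (E a b j).re with he
  set h : ℝ → ℝ → ℂ := tauRatio (spec a b u) d e with hh
  set Q : ℂ := ∑ k, (weight a b k : ℂ) with hQ
  set K : ℂ := amp a b j * Complex.exp (Complex.I * θ) with hK
  set G : ℝ → ℝ → ℂ := fun x t =>
    Complex.exp (Complex.I * (-e * x + (-e ^ 2 + 2 * Q) * t)) with hG
  have hψ : darkPsi a b u v d θ j = fun x t => K * h x t * G x t := by
    funext x t
    exact darkPsi_eq ha_inj hab ha_real hb huv hne d θ j x t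
  have hGx : ∀ x t, HasDerivAt (fun x => G x t) (-(Complex.I * e) * G x t) x := by
    intro x t
    have h5 := ((((Complex.ofRealCLM.hasDerivAt (x := x)).const_mul (-(e : ℂ))).add_const
      ((-(e : ℂ) ^ 2 + 2 * Q) * t)).const_mul Complex.I).cexp
    refine h5.congr_deriv ?_
    simp only [hG, Complex.ofRealCLM_apply, Complex.ofReal_one]
    ring
  have hGt : HasDerivAt (fun t => G x t) (Complex.I * (-(e : ℂ) ^ 2 + 2 * Q) * G x t) t := by
    have h5 := ((((Complex.ofRealCLM.hasDerivAt (x := t)).const_mul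
      (-(e : ℂ) ^ 2 + 2 * Q)).const_add (-(e : ℂ) * x)).const_mul Complex.I).cexp
    refine h5.congr_deriv ?_
    simp only [hG, Complex.ofRealCLM_apply, Complex.ofReal_one]
    ring
  have hψt : deriv (fun τ => darkPsi a b u v d θ j x τ) t =
      K * (ht x t + Complex.I * (-(e : ℂ) ^ 2 + 2 * Q) * h x t) * G x t := by
    rw [hψ]
    refine (((h3 x t).const_mul K).mul hGt).deriv.trans ?_
    ring
  have hψx : deriv (fun ξ => darkPsi a b u v d θ j ξ t) = fun ξ =>
      K * (hx ξ t - Complex.I * e * h ξ t) * G ξ t := by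
    funext ξ
    rw [hψ]
    refine (((h1 ξ t).const_mul K).mul (hGx ξ t)).deriv.trans ?_
    ring
  have hψxx : iteratedDeriv 2 (fun ξ => darkPsi a b u v d θ j ξ t) x =
      K * (hxx x t - 2 * Complex.I * e * hx x t - (e : ℂ) ^ 2 * h x t) * G x t := by
    rw [iteratedDeriv_succ, iteratedDeriv_one, hψx]
    refine ((((h2 x t).fun_sub ((h1 x t).const_mul (Complex.I * e))).const_mul K).mul
      (hGx x t)).deriv.trans ?_
    linear_combination (K * (e : ℂ) ^ 2 * h x t * G x t) * Complex.I_sq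
  have hsum : ∑ k, (darkSign a b k : ℂ) * ((‖darkPsi a b u v d θ k x t‖ : ℝ) : ℂ) ^ 2 =
      ∑ k, (weight a b k : ℂ) *
        ((‖tauRatio (spec a b u) d (E a b k).re x t‖ : ℂ) ^ 2 - 1) + Q := by
    rw [hQ, ← Finset.sum_add_distrib]
    refine Finset.sum_congr rfl fun k _ => ?_
    rw [norm_darkPsi ha_inj hab ha_real hb huv hne,
      ← (darkSign_mul_amp_sq ha_inj hab ha_real hb k).2.2]
    push_cast
    ring
  rw [hψt, hψxx, hsum, hψ]
  linear_combination (K * G x t) * h4 x t +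
    (K * G x t * (-(e : ℂ) ^ 2 + 2 * Q) * h x t) * Complex.I_sq

/-- If all signs were positive, the weights would be positive and the equation `f u = f v` could not
hold. -/
theorem darkSign_ne_one (hf : ∀ k, ratFun a b (u k) = ratFun a b (v k)) (k : Fin N) :
    darkSign a b ≠ fun _ => 1 := by
  intro hs
  have h := spec_condition ha_inj hab ha_real hb huv hne hf k
  have hterm : ∀ j, (weight a b j : ℂ) /
      ((spec a b u k + (E a b j).re) * (conj (spec a b u k) + (E a b j).re)) =
      ((weight a b j / Complex.normSq (spec a b u k + (E a b j).re) : ℝ) : ℂ) := by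
    intro j
    rw [Complex.ofReal_div, ← Complex.mul_conj, map_add, Complex.conj_ofReal]
  simp only [hterm] at h
  rw [← Complex.ofReal_sum, ← Complex.ofReal_one, ← Complex.ofReal_add,
    Complex.ofReal_eq_zero] at h
  have hnn : 0 ≤ ∑ j, weight a b j / Complex.normSq (spec a b u k + (E a b j).re) := by
    refine Finset.sum_nonneg fun j _ => div_nonneg ?_ (Complex.normSq_nonneg _)
    rw [← (darkSign_mul_amp_sq ha_inj hab ha_real hb j).2.2, hs, one_mul]
    exact sq_nonneg _
  linarith

end Assembly

end DarkSoliton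

theorem mainTheorem2 {n N : ℕ} (hN : 1 ≤ N)
    (a b : Fin (n + 1) → ℂ)
    (ha_inj : Function.Injective a) (hab : ∀ i k, a i ≠ b k)
    (ha_real : ∀ i, (a i).im = 0) (hb_conj : DarkNLS.ConjInvariant b)
    (u v : Fin N → ℂ)
    (huv : ∀ k, (starRingEnd ℂ) (u k) = v k)
    (hne : ∀ i k, v i ≠ u k)
    (hf : ∀ k, DarkNLS.ratFun a b (u k) = DarkNLS.ratFun a b (v k))
    (d : Fin N → ℝ) (θ : ℝ) :
    (∀ j : Fin n,
      (deriv (DarkNLS.ratFun a b) (a (Fin.last n))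
        * deriv (DarkNLS.ratFun a b) (a j.castSucc)).im = 0 ∧
      (DarkNLS.darkSign a b j = 1 ∨ DarkNLS.darkSign a b j = -1)) ∧
    DarkNLS.darkSign a b ≠ (fun _ => 1) ∧
    (∀ (j : Fin n) (x t : ℝ),
      (DarkNLS.T u v (DarkNLS.zArg (DarkNLS.ratFun a b) (a (Fin.last n)) (a j.castSucc)
        u v d 0 x t)).det ≠ 0) ∧
    (∀ j : Fin n, ContDiff ℝ ∞ (fun p : ℝ × ℝ => DarkNLS.darkPsi a b u v d θ j p.1 p.2)) ∧
    DarkNLS.SolvesNLS (DarkNLS.darkSign a b) (DarkNLS.darkPsi a b u v d θ) ∧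
    (∀ j : Fin n, DarkNLS.IsDark (DarkNLS.amp a b j) (DarkNLS.darkPsi a b u v d θ j)) := by
  have hl := DarkSoliton.conj_spec_ne ha_inj hab ha_real hb_conj huv hne
  have : Nonempty (Fin N) := ⟨⟨0, hN⟩⟩
  refine ⟨fun j => ⟨?_, (DarkSoliton.darkSign_mul_amp_sq ha_inj hab ha_real hb_conj j).1⟩,
    DarkSoliton.darkSign_ne_one ha_inj hab ha_real hb_conj huv hne hf ⟨0, hN⟩,
    fun j x t => ?_, fun j => ?_,
    DarkSoliton.solvesNLS_darkPsi ha_inj hab ha_real hb_conj huv hne hf d θ, fun j => ?_⟩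
  · rw [← DarkSoliton.deriv_mul_deriv ha_real hb_conj, Complex.ofReal_im]
  · rw [DarkSoliton.det_T_zero ha_inj hab ha_real hb_conj huv hne, DarkSoliton.tau_ofReal hl]
    exact Complex.ofReal_ne_zero.mpr
      (DarkSoliton.realTau_pos hl (DarkSoliton.solitonExp_pos _ d x t)).ne'
  · simp only [DarkSoliton.darkPsi_eq ha_inj hab ha_real hb_conj huv hne]
    have hfst : ContDiff ℝ ∞ fun p : ℝ × ℝ => (p.1 : ℂ) :=
      Complex.ofRealCLM.contDiff.comp contDiff_fst
    have hsnd : ContDiff ℝ ∞ fun p : ℝ × ℝ => (p.2 : ℂ) :=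
      Complex.ofRealCLM.contDiff.comp contDiff_snd
    exact (contDiff_const.mul (DarkSoliton.contDiff_tauRatio hl d _)).mul
      (contDiff_const.mul ((contDiff_const.mul hfst).add (contDiff_const.mul hsnd))).cexp
  · have hA := (DarkSoliton.darkSign_mul_amp_sq ha_inj hab ha_real hb_conj j).2.1
    refine ⟨hA, fun x t => ?_, fun t => ?_⟩
    · rw [DarkSoliton.norm_darkPsi ha_inj hab ha_real hb_conj huv hne]
      exact mul_lt_of_lt_one_right hA (DarkSoliton.norm_tauRatio_lt_one hl d _ x t)
    · simp only [DarkSoliton.norm_darkPsi ha_inj hab ha_real hb_conj huv hne]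
      constructor
      · simpa using (DarkSoliton.tendsto_norm_tauRatio hl d (DarkNLS.E a b j).re
          one_ne_zero (Filter.tendsto_id.congr fun x => (one_mul x).symm) t).const_mul
          (DarkNLS.amp a b j)
      · simpa using (DarkSoliton.tendsto_norm_tauRatio hl d (DarkNLS.E a b j).re
          (neg_ne_zero.mpr one_ne_zero) (by simpa using Filter.tendsto_neg_atBot_atTop) t).const_mul
          (DarkNLS.amp a b j)
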